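/- Two sensors $A$ and $B$ send updates to a monitor. Each sensor submits its first update at time $0$, and each further update at the very moment at which its previous one is delivered. An update submitted (generated) at time $g$ whose service time is $s$ is delivered at time $g+s$. In the M-M system all service times are independent; those of sensor $A$ are exponential with rate $\mu_A>0$ and those of sensor $B$ are exponential with rate $\mu_B>0$. The information that the monitor holds at time $0$ was generated at time $-a_0$, where $a_0\ge 0$. Let $U(t)$ be the generation time of the freshest information received by the monitor up to time $t$, and let $\Delta(t)=t-U(t)$ be the age of information (AoI). An update is successfully received if it was generated strictly later than everything the monitor received before its delivery (otherwise it is obsolete). Let $0<t_1<t_2<\dots$ be the delivery times of the successfully received updates, $t_0=0$, let $Y_n=t_n-t_{n-1}$, let $T_n$ be the service time of the $n$-th successfully received update, let $Q_n=\int_{t_{n-1}}^{t_n}\Delta(t)\,dt$, and let $N_\tau$ be the number of successfully received updates in $(0,\tau)$. Then: 1. Almost surely, the long-run time-average AoI is $$\lim_{\tau\to\infty}\frac1\tau\int_0^\tau\Delta(t)\,dt=\lim_{\tau\to\infty}\frac1\tau\sum_{n=1}^{N_\tau}Q_n=\frac{2(\mu_A^2+3\mu_A\mu_B+\mu_B^2)}{(\mu_A+\mu_B)^3}.$$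 If $\mu_A=\mu_B=\mu$, this is $\frac{5}{4\mu}$. 2. Almost surely, $Q_n=T_{n-1}Y_n+\tfrac12Y_n^2$ for all $n\ge2$. The variables $Q_n$ and $Y_n$ are integrable for all $n\ge1$, the limits $\mathbb E[Q]=\lim_{n}\mathbb E[Q_n]$ and $\mathbb E[Y]=\lim_n\mathbb E[Y_n]>0$ exist, and the value in 1 equals $\mathbb E[Q]/\mathbb E[Y]$. -/

import Mathlib

open MeasureTheory ProbabilityTheory Filter Topology

noncomputable section

namespace DualQueue

/-- The two sensors (servers). -/
inductive Sensor where
  | A : Sensor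
  | B : Sensor

/-- `S i k` is the service time of the `k`-th update (`k = 0, 1, 2, …`) of sensor `i`. Every
sensor submits its first update at time `0` and each later update at the very moment at which
its previous one is delivered, so the `k`-th update is generated after `k` services. -/
def genTime (S : Sensor → ℕ → ℝ) (i : Sensor) (k : ℕ) : ℝ :=
  ∑ j ∈ Finset.range k, S i j

/-- Time at which the `k`-th update of sensor `i` is delivered to the monitor. -/
def delTime (S : Sensor → ℕ → ℝ) (i : Sensor) (k : ℕ) : ℝ :=
  genTime S i k + S i k

/-- Generation time of the freshest update that the monitor has received by time `t`. The
information held by the monitor at time `0` was generated at time `-a₀`. -/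
def freshest (a₀ : ℝ) (S : Sensor → ℕ → ℝ) (t : ℝ) : ℝ :=
  sSup ({-a₀} ∪ {g | ∃ i k, delTime S i k ≤ t ∧ g = genTime S i k})

/-- Instantaneous age of information at the monitor. -/
def aoi (a₀ : ℝ) (S : Sensor → ℕ → ℝ) (t : ℝ) : ℝ :=
  t - freshest a₀ S t

/-- The `k`-th update of sensor `i` is successfully received, i.e. it is not obsolete: it was
generated later than everything that the monitor has received before its delivery. -/
def IsFresh (a₀ : ℝ) (S : Sensor → ℕ → ℝ) (i : Sensor) (k : ℕ) : Prop :=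
  -a₀ < genTime S i k ∧
    ∀ j l, delTime S j l < delTime S i k → genTime S j l < genTime S i k

/-- The set of delivery times of the successfully received updates. -/
def refreshSet (a₀ : ℝ) (S : Sensor → ℕ → ℝ) : Set ℝ :=
  {t | ∃ i k, IsFresh a₀ S i k ∧ delTime S i k = t}

/-- Delivery time of the `n`-th successfully received update for `n ≥ 1`; it is `0` for
`n = 0`. -/
def refreshTime (a₀ : ℝ) (S : Sensor → ℕ → ℝ) : ℕ → ℝ
  | 0 => 0
  | n + 1 => sInf {t | t ∈ refreshSet a₀ S ∧ refreshTime a₀ S n < t}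

/-- Inter-arrival time `Y₍ₙ₎` between the `(n-1)`-th and the `n`-th successfully received
updates (used for `n ≥ 1`). -/
def interArrival (a₀ : ℝ) (S : Sensor → ℕ → ℝ) (n : ℕ) : ℝ :=
  refreshTime a₀ S n - refreshTime a₀ S (n - 1)

/-- The area `Q₍ₙ₎` under the age curve between the `(n-1)`-th and the `n`-th successfully
received updates (used for `n ≥ 1`). -/
def area (a₀ : ℝ) (S : Sensor → ℕ → ℝ) (n : ℕ) : ℝ :=
  ∫ t in (refreshTime a₀ S (n - 1))..(refreshTime a₀ S n), aoi a₀ S t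

/-- The number of successfully received updates in the time interval `(0, τ)`. -/
def numRefresh (a₀ : ℝ) (S : Sensor → ℕ → ℝ) (τ : ℝ) : ℕ :=
  (refreshSet a₀ S ∩ Set.Ioo 0 τ).ncard

/-- The average age of information over `[0, τ]`. -/
def timeAvgAoI (a₀ : ℝ) (S : Sensor → ℕ → ℝ) (τ : ℝ) : ℝ :=
  (1 / τ) * ∫ t in (0 : ℝ)..τ, aoi a₀ S t

/-- The average over `(0, τ)` of the areas of the successfully received updates. -/
def timeAvgArea (a₀ : ℝ) (S : Sensor → ℕ → ℝ) (τ : ℝ) : ℝ :=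
  (1 / τ) * ∑ n ∈ Finset.Icc 1 (numRefresh a₀ S τ), area a₀ S n

/-- M-M system: all service times are independent, those of sensor A are exponential with
rate `μA` and those of sensor B are exponential with rate `μB`. -/
structure IsMMSystem {Ω : Type*} [MeasurableSpace Ω] (P : Measure Ω) (μA μB : ℝ)
    (S : Sensor → ℕ → Ω → ℝ) : Prop where
  law_A : ∀ k, HasLaw (S Sensor.A k) (expMeasure μA) P
  law_B : ∀ k, HasLaw (S Sensor.B k) (expMeasure μB) P
  indep : iIndepFun (fun p : Sensor × ℕ => S p.1 p.2) P

end DualQueue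

end

namespace DualQueue

open scoped ENNReal

/-! Merge the deliveries of both sensors, obsolete ones included, into one stream. By memorylessness
of the exponential law, once the first delivery has happened the residual service times form a fresh
copy of the system, independent of that delivery (`map_gap_residual`). Iterating, the gaps between
merged deliveries are i.i.d. exponential with rate s = μA + μB, the delivering sensors (marks) are
i.i.d. with probabilities p = μA/s and q = μB/s, and gaps and marks are independent of each other
(`indepFun_gaps_marks`).

The rest of the model is a deterministic function of gaps and marks. Call a delivery a switch if it
comes from another sensor than the preceding delivery. Without a switch, the delivered update was
generated at the preceding delivery. With a switch, the freshest known update was generated two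
deliveries back, because one of the last two deliveries comes from the sensor that delivered just
before them (`best_succ`). So the age after a delivery is the last gap, plus the gap before it in
case of a switch. A delivery after the first is obsolete exactly when it is a switch and its
predecessor is not (`best_lt_iff`).

Time average: the area between two consecutive deliveries depends on three consecutive gaps and two
marks, and has mean (2 + 2pq)/s². The strong law on each residue class modulo 3, divided by the mean
gap 1/s, gives (2 + 2pq)/s, which is the claimed value. Summing the areas of received updates gives
the same integral stopped at the last reception. Receptions are at most three deliveries apart, so
the limit is unchanged.

Ratio of means: seen at successive receptions, the pair (switch or not, sensor) is a four-state
Markov chain, which converges by a Doeblin contraction (`tendsto_chainOp_iterate`). In the limit, a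
switch at the reception and an obsolete delivery right after it both have probability σ = pq/(1 -
pq). Since the marks select which gaps enter and are independent of them, the limiting means are
E[Y] = (1 + σ)/s and E[Q] = (2 + 4σ)/s², with ratio (2 + 2pq)/s. -/

instance : DecidableEq Sensor := fun a b => by
  cases a <;> cases b <;> first | exact isTrue rfl | exact isFalse (by simp)

instance : Fintype Sensor := ⟨{Sensor.A, Sensor.B}, fun i => by cases i <;> simp⟩

instance : MeasurableSpace Sensor := ⊤

instance : DiscreteMeasurableSpace Sensor := ⟨fun _ => trivial⟩

/-- Disjoint subfamilies of an independent family are independent. -/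
theorem indepFun_subfamilies {Ω ι α γ : Type*} [MeasurableSpace Ω] {P : Measure Ω}
    {𝓧 : ι → Type*} [∀ i, MeasurableSpace (𝓧 i)] {X : ∀ i, Ω → 𝓧 i} (hm : ∀ i, Measurable (X i))
    (h : iIndepFun X P) (f : α → ι) (g : γ → ι) (hfg : ∀ a c, f a ≠ g c) :
    IndepFun (fun ω a => X (f a) ω) (fun ω c => X (g c) ω) P := by
  have key := indep_iSup_of_disjoint (fun i => (hm i).comap_le) ((iIndepFun_iff_iIndep _ _ _).1 h)
    (S := Set.range f) (T := Set.range g) (by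
      rw [Set.disjoint_left]; rintro _ ⟨a, rfl⟩ ⟨c, hc⟩; exact hfg a c hc.symm)
  rw [IndepFun_iff_Indep]
  refine indep_of_indep_of_le_left (indep_of_indep_of_le_right key ?_) ?_
  · rw [MeasurableSpace.pi, MeasurableSpace.comap_iSup]
    refine iSup_le fun c => ?_
    rw [MeasurableSpace.comap_comp]
    exact le_iSup₂_of_le (g c) ⟨c, rfl⟩ le_rfl
  · rw [MeasurableSpace.pi, MeasurableSpace.comap_iSup]
    refine iSup_le fun c => ?_
    rw [MeasurableSpace.comap_comp]
    exact le_iSup₂_of_le (f c) ⟨c, rfl⟩ le_rfl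

/-! ### Independence along the iterates of a splitting map -/

section Iterates

variable {X Z : Type*} [MeasurableSpace X] [MeasurableSpace Z] {ν : Measure X}
  [IsProbabilityMeasure ν] {ζ : Measure Z} {z : X → Z} {T : X → X}

theorem map_head (hz : Measurable z) (hT : Measurable T)
    (h : ν.map (fun x => (z x, T x)) = ζ.prod ν) : ν.map z = ζ := by
  have := congrArg (Measure.map Prod.fst) h
  rwa [Measure.map_map measurable_fst (hz.prodMk hT), Measure.map_fst_prod, measure_univ,
    one_smul] at this

theorem measurePreserving_tail [IsProbabilityMeasure ζ] (hz : Measurable z) (hT : Measurable T)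
    (h : ν.map (fun x => (z x, T x)) = ζ.prod ν) : MeasurePreserving T ν ν := by
  refine ⟨hT, ?_⟩
  have := congrArg (Measure.map Prod.snd) h
  rwa [Measure.map_map measurable_snd (hz.prodMk hT), Measure.map_snd_prod, measure_univ,
    one_smul] at this

/-- The hypothesis `h` splits off the coordinate `k = 0` and leaves the event of the shifted sets
under `ν`; `B` stays general so that the induction can shift it. -/
theorem measure_iterates (hz : Measurable z) (hT : Measurable T)
    (h : ν.map (fun x => (z x, T x)) = ζ.prod ν) (n : ℕ) (B : ℕ → Set Z)
    (hB : ∀ k, MeasurableSet (B k)) :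
    ν (⋂ k ∈ Finset.range n, (fun x => z (T^[k] x)) ⁻¹' B k)
      = ∏ k ∈ Finset.range n, ζ (B k) := by
  induction n generalizing B with
  | zero => simp
  | succ n ih =>
    have hset : (⋂ k ∈ Finset.range (n + 1), (fun x => z (T^[k] x)) ⁻¹' B k)
        = (fun x => (z x, T x)) ⁻¹'
          (B 0 ×ˢ (⋂ k ∈ Finset.range n, (fun x => z (T^[k] x)) ⁻¹' B (k + 1))) := by
      ext x
      simp only [Set.mem_iInter, Set.mem_preimage, Set.mem_prod, Finset.mem_range]
      constructor
      · intro hx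
        exact ⟨hx 0 (by omega), fun k hk => by
          have := hx (k + 1) (by omega)
          rwa [Function.iterate_succ_apply] at this⟩
      · rintro ⟨h0, hx⟩ k hk
        cases k with
        | zero => exact h0
        | succ k => rw [Function.iterate_succ_apply]; exact hx k (by omega)
    have hm : MeasurableSet (⋂ k ∈ Finset.range n, (fun x => z (T^[k] x)) ⁻¹' B (k + 1)) :=
      Finset.measurableSet_biInter _ fun k _ => (hz.comp (hT.iterate k)) (hB _)
    rw [hset, ← Measure.map_apply (hz.prodMk hT) ((hB 0).prod hm), h, Measure.prod_prod,
      ih (fun k => B (k + 1)) (fun k => hB _), Finset.prod_range_succ']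
    ring

/-- If `x ↦ (z x, T x)` maps `ν` to `ζ ⊗ ν`, then the `z (T^[n] x)` are independent. -/
theorem iIndepFun_iterates [IsProbabilityMeasure ζ] (hz : Measurable z) (hT : Measurable T)
    (h : ν.map (fun x => (z x, T x)) = ζ.prod ν) :
    iIndepFun (fun n x => z (T^[n] x)) ν := by
  classical
  rw [iIndepFun_iff_measure_inter_preimage_eq_mul]
  intro s B hB
  obtain ⟨n, hn⟩ : ∃ n, s ⊆ Finset.range n := ⟨s.sup id + 1, fun k hk => by
    have := Finset.le_sup (f := id) hk
    simp only [id] at this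
    exact Finset.mem_range.2 (by omega)⟩
  have hmp := measurePreserving_tail hz hT h
  -- Independence over an arbitrary finite `s` is reduced to an initial segment by imposing no
  -- condition outside `s`.
  have key := measure_iterates hz hT h n (fun k => if k ∈ s then B k else Set.univ) (by
    intro k; split_ifs with hk
    · exact hB k hk
    · exact MeasurableSet.univ)
  have hset : (⋂ k ∈ Finset.range n, (fun x => z (T^[k] x)) ⁻¹' (if k ∈ s then B k else Set.univ))
      = ⋂ k ∈ s, (fun x => z (T^[k] x)) ⁻¹' B k := by
    ext x
    simp only [Set.mem_iInter, Set.mem_preimage]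
    constructor
    · intro hx k hk
      have := hx k (hn hk)
      rwa [if_pos hk] at this
    · intro hx k _
      split_ifs with hk
      · exact hx k hk
      · trivial
  rw [hset] at key
  rw [key, ← Finset.prod_subset hn]
  · refine Finset.prod_congr rfl fun k hk => ?_
    rw [if_pos hk, ← map_head hz hT h, Measure.map_apply hz (hB k hk),
      ← (hmp.iterate k).measure_preimage ((hz (hB k hk)).nullMeasurableSet)]
    rfl
  · intro k _ hk
    rw [if_neg hk, measure_univ]

end Iterates

/-! ### Two competing exponential clocks -/

section Exponential

/-- Memorylessness in density form: for `u ≥ 0` both sides equal `a * b * exp (-(a + b) * u - b *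
w)`, so the winning time `u` and the residual `w` of the loser separate, with winning probability `a
/ (a + b)`. -/
theorem exponentialPDF_mul_exponentialPDF_add {a b : ℝ} (ha : 0 < a) (hb : 0 < b) {u w : ℝ}
    (hw : 0 ≤ w) :
    exponentialPDF a u * exponentialPDF b (w + u)
      = ENNReal.ofReal (a / (a + b)) * (exponentialPDF (a + b) u * exponentialPDF b w) := by
  rcases lt_or_ge u 0 with hu | hu
  · simp [exponentialPDF_of_neg hu]
  · rw [exponentialPDF_of_nonneg hu, exponentialPDF_of_nonneg (add_nonneg hw hu),
      exponentialPDF_of_nonneg hu, exponentialPDF_of_nonneg hw, ← ENNReal.ofReal_mul (by positivity),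
      ← ENNReal.ofReal_mul (by positivity), ← ENNReal.ofReal_mul (by positivity)]
    congr 1
    have : Real.exp (-(u * (a + b))) * Real.exp (-(b * w))
        = Real.exp (-(a * u)) * Real.exp (-(b * (w + u))) := by
      rw [← Real.exp_add, ← Real.exp_add]; ring_nf
    field_simp
    linear_combination (-1 : ℝ) * this

theorem expMeasure_eq (r : ℝ) : expMeasure r = volume.withDensity (exponentialPDF r) := rfl

theorem measurable_exponentialPDF (r : ℝ) : Measurable (exponentialPDF r) :=
  (measurable_exponentialPDFReal r).ennreal_ofReal

theorem lintegral_expMeasure (r : ℝ) {G : ℝ → ℝ≥0∞} (hG : Measurable G) :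
    ∫⁻ x, G x ∂(expMeasure r) = ∫⁻ x, exponentialPDF r x * G x := by
  rw [expMeasure_eq, lintegral_withDensity_eq_lintegral_mul _ (measurable_exponentialPDF r) hG]
  rfl

/-- The first of two competing exponential clocks and the residual time of the other one. -/
theorem lintegral_race {a b : ℝ} (ha : 0 < a) (hb : 0 < b) (c : ℝ → ℝ → Prop)
    [∀ u v, Decidable (c u v)] (hc : MeasurableSet {p : ℝ × ℝ | c p.1 p.2})
    (hc1 : ∀ u v, u < v → c u v) (hc2 : ∀ u v, c u v → u ≤ v) {G : ℝ → ℝ → ℝ≥0∞}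
    (hG : Measurable (fun p : ℝ × ℝ => G p.1 p.2)) :
    ∫⁻ u, ∫⁻ v, (if c u v then G u (v - u) else 0) ∂(expMeasure b) ∂(expMeasure a)
      = ENNReal.ofReal (a / (a + b)) * ∫⁻ u, ∫⁻ w, G u w ∂(expMeasure b) ∂(expMeasure (a + b)) := by
  have := isProbabilityMeasure_expMeasure hb
  have hm1 : Measurable (fun p : ℝ × ℝ => if c p.1 p.2 then G p.1 (p.2 - p.1) else 0) :=
    Measurable.ite hc (hG.comp (by fun_prop : Measurable fun p : ℝ × ℝ => (p.1, p.2 - p.1)))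
      measurable_const
  have hm2 : Measurable fun u => ∫⁻ v, (if c u v then G u (v - u) else 0) ∂(expMeasure b) :=
    hm1.lintegral_prod_right'
  have hm3 : Measurable fun u => ∫⁻ w, G u w ∂(expMeasure b) := hG.lintegral_prod_right'
  have hm4 : Measurable fun u => exponentialPDF (a + b) u * ∫⁻ w, G u w ∂(expMeasure b) :=
    (measurable_exponentialPDF _).mul hm3
  rw [lintegral_expMeasure a hm2, lintegral_expMeasure (a + b) hm3, ← lintegral_const_mul _ hm4]
  refine lintegral_congr fun u => ?_
  have hGu : Measurable (G u) := hG.comp (measurable_const.prodMk measurable_id)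
  have hmu : Measurable (fun v => if c u v then G u (v - u) else 0) :=
    hm1.comp (measurable_const.prodMk measurable_id)
  have hm5 : Measurable fun w => exponentialPDF b (w + u)
      * (if c u (w + u) then G u (w + u - u) else 0) :=
    ((measurable_exponentialPDF b).comp (measurable_add_const u)).mul
      (hmu.comp (measurable_add_const u))
  have hm6 : Measurable fun w => exponentialPDF b w * G u w := (measurable_exponentialPDF b).mul hGu
  have hm7 : Measurable fun w => exponentialPDF (a + b) u * (exponentialPDF b w * G u w) :=
    hm6.const_mul _
  rw [lintegral_expMeasure b hmu, lintegral_expMeasure b hGu,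
    ← lintegral_add_right_eq_self (μ := volume) _ u, ← lintegral_const_mul _ hm5,
    ← lintegral_const_mul _ hm6, ← lintegral_const_mul _ hm7]
  -- After the substitution `v = w + u`, the condition `c` is settled by the sign of `w`; only the
  -- tie `w = 0` is left open, and it is a null set. This is why one lemma covers both tie-breaking
  -- rules.
  refine lintegral_congr_ae ?_
  filter_upwards [(measure_eq_zero_iff_ae_notMem.1 (measure_singleton (μ := volume) (0 : ℝ)))]
    with w hw
  have hw0 : w ≠ 0 := hw
  simp only [add_sub_cancel_right]
  rcases lt_or_gt_of_ne hw0 with h | h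
  · rw [if_neg (fun hcc => by have := hc2 _ _ hcc; linarith), exponentialPDF_of_neg h]
    simp
  · rw [if_pos (hc1 _ _ (by linarith)), ← mul_assoc,
      exponentialPDF_mul_exponentialPDF_add ha hb h.le]
    ring

theorem ae_expMeasure_pos (r : ℝ) : ∀ᵐ x ∂(expMeasure r), 0 < x := by
  rw [expMeasure_eq, ae_withDensity_iff (measurable_exponentialPDF r)]
  filter_upwards [(measure_eq_zero_iff_ae_notMem.1 (measure_singleton (μ := volume) (0 : ℝ)))]
    with w hw hne
  have hw0 : w ≠ 0 := hw
  by_contra hcon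
  exact hne (exponentialPDF_of_neg (lt_of_le_of_ne (not_lt.1 hcon) hw0))

theorem expMeasure_singleton (r x : ℝ) : expMeasure r {x} = 0 := by
  rw [expMeasure_eq]
  exact withDensity_absolutelyContinuous _ _ (measure_singleton x)

end Exponential

end DualQueue

/-! ### The law of the service times and its renewal at the first delivery -/

namespace DualQueue

open scoped ENNReal

/-- Law of the service times when those of sensor `i` are independent with law `m i`. -/
noncomputable def serviceLaw (m : Sensor → Measure ℝ) : Measure (Sensor → ℕ → ℝ) :=
  (Measure.infinitePi fun p : Sensor × ℕ => m p.1).map fun x i k => x (i, k)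

/-- Insert `w` as the first service time of sensor `i`. -/
def push (i : Sensor) (w : ℝ) (S : Sensor → ℕ → ℝ) : Sensor → ℕ → ℝ :=
  fun j k => if j = i then (match k with | 0 => w | k + 1 => S j k) else S j k

/-- Remove the first service time of sensor `i`. -/
def dropFirst (i : Sensor) (S : Sensor → ℕ → ℝ) : Sensor → ℕ → ℝ :=
  fun j k => if j = i then S j (k + 1) else S j k

/-- The sensor whose first service is completed first. -/
noncomputable def nextSensor (S : Sensor → ℕ → ℝ) : Sensor :=
  if S Sensor.A 0 < S Sensor.B 0 then Sensor.A else Sensor.B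

/-- Time until the first delivery. -/
noncomputable def gap (S : Sensor → ℕ → ℝ) : ℝ := S (nextSensor S) 0

/-- Residual service times after the first delivery. -/
noncomputable def residual (S : Sensor → ℕ → ℝ) : Sensor → ℕ → ℝ :=
  if S Sensor.A 0 < S Sensor.B 0 then
    push Sensor.B (S Sensor.B 0 - S Sensor.A 0) (dropFirst Sensor.A (dropFirst Sensor.B S))
  else push Sensor.A (S Sensor.A 0 - S Sensor.B 0) (dropFirst Sensor.A (dropFirst Sensor.B S))

theorem push_dropFirst (i : Sensor) (S : Sensor → ℕ → ℝ) : push i (S i 0) (dropFirst i S) = S := by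
  funext j k
  by_cases h : j = i
  · subst h; cases k <;> simp [push, dropFirst]
  · simp [push, dropFirst, h]

theorem measurable_serviceTime (i : Sensor) (k : ℕ) :
    Measurable fun S : Sensor → ℕ → ℝ => S i k :=
  (measurable_pi_apply k).comp (measurable_pi_apply i)

theorem measurable_push (i : Sensor) :
    Measurable fun p : ℝ × (Sensor → ℕ → ℝ) => push i p.1 p.2 := by
  refine measurable_pi_iff.2 fun j => measurable_pi_iff.2 fun k => ?_
  by_cases h : j = i
  · cases k <;> simp only [push, h, if_true] <;> fun_prop
  · simp only [push, h, if_false]; fun_prop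

theorem measurable_dropFirst (i : Sensor) : Measurable (dropFirst i) := by
  refine measurable_pi_iff.2 fun j => measurable_pi_iff.2 fun k => ?_
  by_cases h : j = i
  · simp only [dropFirst, h, if_true]; fun_prop
  · simp only [dropFirst, h, if_false]; fun_prop

theorem measurableSet_first_lt :
    MeasurableSet {S : Sensor → ℕ → ℝ | S Sensor.A 0 < S Sensor.B 0} :=
  measurableSet_lt (by fun_prop) (by fun_prop)

theorem measurable_nextSensor : Measurable nextSensor :=
  Measurable.ite measurableSet_first_lt measurable_const measurable_const

theorem measurable_gap : Measurable gap := by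
  have : gap = fun S => if S Sensor.A 0 < S Sensor.B 0 then S Sensor.A 0 else S Sensor.B 0 := by
    funext S; simp only [gap, nextSensor]; split_ifs <;> rfl
  rw [this]
  exact Measurable.ite measurableSet_first_lt (by fun_prop) (by fun_prop)

theorem measurable_residual : Measurable residual :=
  Measurable.ite measurableSet_first_lt
    ((measurable_push _).comp ((by fun_prop : Measurable fun S : Sensor → ℕ → ℝ =>
      S Sensor.B 0 - S Sensor.A 0).prodMk ((measurable_dropFirst _).comp (measurable_dropFirst _))))
    ((measurable_push _).comp ((by fun_prop : Measurable fun S : Sensor → ℕ → ℝ =>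
      S Sensor.A 0 - S Sensor.B 0).prodMk ((measurable_dropFirst _).comp (measurable_dropFirst _))))

section Law

theorem hasLaw_serviceLaw {m : Sensor → Measure ℝ} {Ω : Type*} [MeasurableSpace Ω] {P : Measure Ω}
    {S : Sensor → ℕ → Ω → ℝ} (hS : ∀ i k, HasLaw (S i k) (m i) P)
    (hind : iIndepFun (fun (p : Sensor × ℕ) => S p.1 p.2) P) :
    HasLaw (fun ω i k => S i k ω) (serviceLaw m) P := by
  have hm : AEMeasurable (fun ω (p : Sensor × ℕ) => S p.1 p.2 ω) P :=
    aemeasurable_pi_iff.2 fun p => (hS p.1 p.2).aemeasurable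
  have h := hind.hasLaw_infinitePi (fun p : Sensor × ℕ => hS p.1 p.2) hm
  have hc : Measurable fun (x : Sensor × ℕ → ℝ) (i : Sensor) (k : ℕ) => x (i, k) := by fun_prop
  refine ⟨aemeasurable_pi_iff.2 fun i => aemeasurable_pi_iff.2 fun k => (hS i k).aemeasurable, ?_⟩
  rw [serviceLaw, ← h.map_eq, AEMeasurable.map_map_of_aemeasurable hc.aemeasurable hm]
  rfl

variable {m : Sensor → Measure ℝ} [∀ i, IsProbabilityMeasure (m i)]

instance : IsProbabilityMeasure (serviceLaw m) :=
  Measure.isProbabilityMeasure_map (Measurable.aemeasurable (by fun_prop))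

theorem iIndepFun_serviceLaw :
    iIndepFun (fun (p : Sensor × ℕ) (S : Sensor → ℕ → ℝ) => S p.1 p.2) (serviceLaw m) := by
  rw [iIndepFun_iff_map_fun_eq_infinitePi_map (by fun_prop), serviceLaw,
    Measure.map_map (by fun_prop) (by fun_prop)]
  have : ∀ p : Sensor × ℕ, Measure.map (fun S : Sensor → ℕ → ℝ => S p.1 p.2)
      (Measure.map (fun (x : Sensor × ℕ → ℝ) i k => x (i, k))
        (Measure.infinitePi fun p : Sensor × ℕ => m p.1)) = m p.1 := by
    intro p
    rw [Measure.map_map (by fun_prop) (by fun_prop)]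
    exact Measure.infinitePi_map_eval _ p
  simp_rw [this]
  exact Measure.map_id

theorem map_eval_serviceLaw (i : Sensor) (k : ℕ) :
    (serviceLaw m).map (fun S => S i k) = m i := by
  rw [serviceLaw, Measure.map_map (by fun_prop) (by fun_prop)]
  exact Measure.infinitePi_map_eval _ (i, k)

/-- Dropping a head is a reindexing along the injection `f`, whose range misses `(i, 0)`:
injectivity preserves the law of the family, and missing `(i, 0)` makes it independent of the head.
-/
theorem map_head_dropFirst (i : Sensor) :
    (serviceLaw m).map (fun S => (S i 0, dropFirst i S)) = (m i).prod (serviceLaw m) := by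
  let f : Sensor × ℕ → Sensor × ℕ := fun p => if p.1 = i then (p.1, p.2 + 1) else p
  have hf : Function.Injective f := by
    rintro ⟨a, k⟩ ⟨c, l⟩ h
    simp only [f] at h
    split_ifs at h with h1 h2 h2 <;> simp_all
  have hf1 : ∀ p, (f p).1 = p.1 := by intro p; simp only [f]; split_ifs <;> rfl
  have hdrop : ∀ S : Sensor → ℕ → ℝ, dropFirst i S = fun j k => S (f (j, k)).1 (f (j, k)).2 := by
    intro S; funext j k; simp only [dropFirst, f]; split_ifs <;> rfl
  have hind := iIndepFun_serviceLaw (m := m)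
  have h1 := indepFun_subfamilies (by fun_prop) hind (fun _ : Unit => (i, 0)) f (by
    rintro _ ⟨a, k⟩ h
    simp only [f] at h
    split_ifs at h with h1 <;> simp_all)
  have h2 : IndepFun (fun S : Sensor → ℕ → ℝ => S i 0) (dropFirst i) (serviceLaw m) := by
    have hev : Measurable fun x : Unit → ℝ => x () := measurable_pi_apply ()
    have := h1.comp (ψ := fun (x : Sensor × ℕ → ℝ) j k => x (j, k)) hev (by fun_prop)
    rw [funext hdrop]
    exact this
  rw [(indepFun_iff_map_prod_eq_prod_map_map (measurable_serviceTime i 0).aemeasurable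
    (measurable_dropFirst i).aemeasurable).1 h2, map_eval_serviceLaw]
  congr 1
  have h3 := hasLaw_serviceLaw (m := m) (P := serviceLaw m)
    (S := fun j k S => S (f (j, k)).1 (f (j, k)).2) (fun j k => by
      refine ⟨(measurable_serviceTime _ _).aemeasurable, ?_⟩
      rw [map_eval_serviceLaw, hf1]) (hind.precomp hf)
  refine Eq.trans ?_ h3.map_eq
  congr 1
  funext S; exact hdrop S

theorem lintegral_push (i : Sensor) {F : (Sensor → ℕ → ℝ) → ℝ≥0∞} (hF : Measurable F) :
    ∫⁻ y, ∫⁻ w, F (push i w y) ∂(m i) ∂(serviceLaw m) = ∫⁻ S, F S ∂(serviceLaw m) := by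
  have hFp : Measurable fun p : ℝ × (Sensor → ℕ → ℝ) => F (push i p.1 p.2) :=
    hF.comp (measurable_push i)
  have h1 : ∫⁻ p, F (push i p.1 p.2) ∂((m i).prod (serviceLaw m)) = ∫⁻ S, F S ∂(serviceLaw m) := by
    rw [← map_head_dropFirst, lintegral_map hFp
      ((measurable_serviceTime i 0).prodMk (measurable_dropFirst i))]
    simp only [push_dropFirst]
  rw [← h1, lintegral_prod_symm _ hFp.aemeasurable]

end Law

section Exponential

variable (μ : Sensor → ℝ)

/-- Law of the sensor of a delivery. -/
noncomputable def markLaw : Measure Sensor :=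
  ENNReal.ofReal (μ Sensor.A / (μ Sensor.A + μ Sensor.B)) • Measure.dirac Sensor.A
    + ENNReal.ofReal (μ Sensor.B / (μ Sensor.A + μ Sensor.B)) • Measure.dirac Sensor.B

variable {μ}

theorem isProbabilityMeasure_markLaw (hμ : ∀ i, 0 < μ i) : IsProbabilityMeasure (markLaw μ) := by
  have hA := hμ Sensor.A
  have hB := hμ Sensor.B
  refine ⟨?_⟩
  simp only [markLaw, Measure.add_apply, Measure.smul_apply, measure_univ, smul_eq_mul, mul_one]
  rw [← ENNReal.ofReal_add (by positivity) (by positivity), ← add_div, div_self (by positivity),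
    ENNReal.ofReal_one]

/-- With both heads exposed, a delivery consumes the winner's head and shortens the loser's; the
tail `y` is untouched. -/
theorem residual_push_push (u v : ℝ) (y : Sensor → ℕ → ℝ) :
    residual (push Sensor.A u (push Sensor.B v y))
      = if u < v then push Sensor.B (v - u) y else push Sensor.A (u - v) y := by
  have h1 : dropFirst Sensor.A (dropFirst Sensor.B (push Sensor.A u (push Sensor.B v y))) = y := by
    funext j k
    cases j <;> simp [dropFirst, push]
  have hA : push Sensor.A u (push Sensor.B v y) Sensor.A 0 = u := by simp [push]
  have hB : push Sensor.A u (push Sensor.B v y) Sensor.B 0 = v := by simp [push]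
  rw [residual, h1, hA, hB]

/-- After the first delivery the residual system is a fresh copy, independent of the delivery. -/
theorem map_gap_residual (hμ : ∀ i, 0 < μ i) :
    (serviceLaw fun i => expMeasure (μ i)).map (fun S => ((gap S, nextSensor S), residual S))
      = ((expMeasure (μ Sensor.A + μ Sensor.B)).prod (markLaw μ)).prod
        (serviceLaw fun i => expMeasure (μ i)) := by
  have hA := hμ Sensor.A
  have hB := hμ Sensor.B
  have hAB : 0 < μ Sensor.A + μ Sensor.B := by positivity
  have : ∀ i, IsProbabilityMeasure (expMeasure (μ i)) :=
    fun i => isProbabilityMeasure_expMeasure (hμ i)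
  have := isProbabilityMeasure_expMeasure hAB
  have := isProbabilityMeasure_markLaw hμ
  have hΦ : Measurable fun S => ((gap S, nextSensor S), residual S) :=
    (measurable_gap.prodMk measurable_nextSensor).prodMk measurable_residual
  refine Measure.ext_of_lintegral _ fun F hF => ?_
  rw [lintegral_map hF hΦ]
  set ν := serviceLaw fun i => expMeasure (μ i) with hν
  have hpp : ∀ u v y, F ((gap (push Sensor.A u (push Sensor.B v y)),
        nextSensor (push Sensor.A u (push Sensor.B v y))),
        residual (push Sensor.A u (push Sensor.B v y)))
      = (if u < v then F ((u, Sensor.A), push Sensor.B (v - u) y) else 0)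
        + (if v ≤ u then F ((v, Sensor.B), push Sensor.A (u - v) y) else 0) := by
    intro u v y
    rw [residual_push_push]
    have hA : push Sensor.A u (push Sensor.B v y) Sensor.A 0 = u := by simp [push]
    have hB : push Sensor.A u (push Sensor.B v y) Sensor.B 0 = v := by simp [push]
    by_cases h : u < v
    · simp [gap, nextSensor, hA, hB, h, not_le.2 h]
    · simp [gap, nextSensor, hA, hB, h, not_lt.1 h]
  have hmA : Measurable fun q : (ℝ × ℝ) × (Sensor → ℕ → ℝ) =>
      F ((q.1.1, Sensor.A), push Sensor.B q.1.2 q.2) :=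
    hF.comp (((by fun_prop : Measurable fun q : (ℝ × ℝ) × (Sensor → ℕ → ℝ) => q.1.1).prodMk
      measurable_const).prodMk ((measurable_push _).comp
        ((by fun_prop : Measurable fun q : (ℝ × ℝ) × (Sensor → ℕ → ℝ) => (q.1.2, q.2)))))
  have hmB : Measurable fun q : (ℝ × ℝ) × (Sensor → ℕ → ℝ) =>
      F ((q.1.1, Sensor.B), push Sensor.A q.1.2 q.2) :=
    hF.comp (((by fun_prop : Measurable fun q : (ℝ × ℝ) × (Sensor → ℕ → ℝ) => q.1.1).prodMk
      measurable_const).prodMk ((measurable_push _).comp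
        ((by fun_prop : Measurable fun q : (ℝ × ℝ) × (Sensor → ℕ → ℝ) => (q.1.2, q.2)))))
  -- the two heads are pulled out of the law
  have hstep : ∫⁻ S, F ((gap S, nextSensor S), residual S) ∂ν
      = ∫⁻ y, ∫⁻ v, ∫⁻ u, ((if u < v then F ((u, Sensor.A), push Sensor.B (v - u) y) else 0)
        + (if v ≤ u then F ((v, Sensor.B), push Sensor.A (u - v) y) else 0))
        ∂(expMeasure (μ Sensor.A)) ∂(expMeasure (μ Sensor.B)) ∂ν := by
    have hFΦ : Measurable fun S => F ((gap S, nextSensor S), residual S) := hF.comp hΦ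
    rw [← lintegral_push (m := fun i => expMeasure (μ i)) Sensor.A hFΦ]
    have hm : Measurable fun y : Sensor → ℕ → ℝ => ∫⁻ w, F ((gap (push Sensor.A w y),
        nextSensor (push Sensor.A w y)), residual (push Sensor.A w y)) ∂(expMeasure (μ Sensor.A)) :=
      (hFΦ.comp (measurable_push Sensor.A)).lintegral_prod_left'
    rw [← lintegral_push (m := fun i => expMeasure (μ i)) Sensor.B hm]
    refine lintegral_congr fun y => lintegral_congr fun v => lintegral_congr fun u => ?_
    exact hpp u v y
  -- For a fixed tail `y`, each possible winner contributes one race. Ties go to `B`, in agreement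
  -- with `nextSensor`.
  have hy : ∀ y, ∫⁻ v, ∫⁻ u, ((if u < v then F ((u, Sensor.A), push Sensor.B (v - u) y) else 0)
        + (if v ≤ u then F ((v, Sensor.B), push Sensor.A (u - v) y) else 0))
        ∂(expMeasure (μ Sensor.A)) ∂(expMeasure (μ Sensor.B))
      = ENNReal.ofReal (μ Sensor.A / (μ Sensor.A + μ Sensor.B))
          * ∫⁻ u, ∫⁻ w, F ((u, Sensor.A), push Sensor.B w y) ∂(expMeasure (μ Sensor.B))
            ∂(expMeasure (μ Sensor.A + μ Sensor.B))
        + ENNReal.ofReal (μ Sensor.B / (μ Sensor.A + μ Sensor.B))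
          * ∫⁻ u, ∫⁻ w, F ((u, Sensor.B), push Sensor.A w y) ∂(expMeasure (μ Sensor.A))
            ∂(expMeasure (μ Sensor.A + μ Sensor.B)) := by
    intro y
    have hGA : Measurable fun p : ℝ × ℝ => F ((p.1, Sensor.A), push Sensor.B p.2 y) :=
      hmA.comp (by fun_prop : Measurable fun p : ℝ × ℝ => (p, y))
    have hGB : Measurable fun p : ℝ × ℝ => F ((p.1, Sensor.B), push Sensor.A p.2 y) :=
      hmB.comp (by fun_prop : Measurable fun p : ℝ × ℝ => (p, y))
    have h1 := lintegral_race hA hB (fun u v => u < v)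
      (measurableSet_lt measurable_fst measurable_snd) (fun _ _ h => h) (fun _ _ h => h.le)
      (G := fun u w => F ((u, Sensor.A), push Sensor.B w y)) hGA
    have h2 := lintegral_race hB hA (fun u v => u ≤ v)
      (measurableSet_le measurable_fst measurable_snd) (fun _ _ h => h.le) (fun _ _ h => h)
      (G := fun u w => F ((u, Sensor.B), push Sensor.A w y)) hGB
    rw [add_comm (μ Sensor.B)] at h2
    rw [← h1, ← h2]
    have hm1 : Measurable fun p : ℝ × ℝ =>
        if p.2 < p.1 then F ((p.2, Sensor.A), push Sensor.B (p.1 - p.2) y) else 0 :=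
      Measurable.ite (measurableSet_lt measurable_snd measurable_fst)
        (hGA.comp (by fun_prop : Measurable fun p : ℝ × ℝ => (p.2, p.1 - p.2))) measurable_const
    have hm2 : Measurable fun p : ℝ × ℝ =>
        if p.1 ≤ p.2 then F ((p.1, Sensor.B), push Sensor.A (p.2 - p.1) y) else 0 :=
      Measurable.ite (measurableSet_le measurable_fst measurable_snd)
        (hGB.comp (by fun_prop : Measurable fun p : ℝ × ℝ => (p.1, p.2 - p.1))) measurable_const
    rw [lintegral_lintegral_swap (μ := expMeasure (μ Sensor.A)) (by
      exact (hm1.comp measurable_swap).aemeasurable)]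
    rw [← lintegral_add_left (by exact hm1.lintegral_prod_right')]
    refine lintegral_congr fun v => ?_
    rw [← lintegral_add_left]
    exact hm1.comp (measurable_const.prodMk measurable_id)
  -- The residual `w` of the loser `j` has the law of a full service of `j`, so putting it back in
  -- front of `y` restores the law `ν`.
  have hsw : ∀ (i j : Sensor) , (Measurable fun q : (ℝ × ℝ) × (Sensor → ℕ → ℝ) =>
      F ((q.1.1, i), push j q.1.2 q.2)) →
      ∫⁻ y, ∫⁻ u, ∫⁻ w, F ((u, i), push j w y) ∂(expMeasure (μ j))
            ∂(expMeasure (μ Sensor.A + μ Sensor.B)) ∂ν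
        = ∫⁻ u, ∫⁻ S, F ((u, i), S) ∂ν ∂(expMeasure (μ Sensor.A + μ Sensor.B)) := by
    intro i j hm
    have hm' : Measurable fun r : (((Sensor → ℕ → ℝ) × ℝ) × ℝ) => F ((r.1.2, i), push j r.2 r.1.1) :=
      hm.comp (by fun_prop : Measurable fun r : (((Sensor → ℕ → ℝ) × ℝ) × ℝ) =>
        ((r.1.2, r.2), r.1.1))
    rw [lintegral_lintegral_swap (by exact hm'.lintegral_prod_right'.aemeasurable)]
    refine lintegral_congr fun u => ?_
    exact lintegral_push (m := fun i => expMeasure (μ i)) j (F := fun S => F ((u, i), S))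
      (hF.comp (measurable_const.prodMk measurable_id))
  have hmI : ∀ (i j : Sensor) , (Measurable fun q : (ℝ × ℝ) × (Sensor → ℕ → ℝ) =>
      F ((q.1.1, i), push j q.1.2 q.2)) → Measurable fun y => ∫⁻ u, ∫⁻ w, F ((u, i), push j w y)
        ∂(expMeasure (μ j)) ∂(expMeasure (μ Sensor.A + μ Sensor.B)) := by
    intro i j hm
    have hm' : Measurable fun r : (((Sensor → ℕ → ℝ) × ℝ) × ℝ) => F ((r.1.2, i), push j r.2 r.1.1) :=
      hm.comp (by fun_prop : Measurable fun r : (((Sensor → ℕ → ℝ) × ℝ) × ℝ) =>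
        ((r.1.2, r.2), r.1.1))
    exact (hm'.lintegral_prod_right').lintegral_prod_right'
  rw [hstep]
  simp_rw [hy]
  rw [lintegral_add_left ((hmI _ _ hmA).const_mul _), lintegral_const_mul _ (hmI _ _ hmA),
    lintegral_const_mul _ (hmI _ _ hmB), hsw _ _ hmA, hsw _ _ hmB]
  rw [lintegral_prod _ hF.aemeasurable]
  have hm8 : Measurable fun z : ℝ × Sensor => ∫⁻ S, F (z, S) ∂ν := hF.lintegral_prod_right'
  rw [lintegral_prod _ hm8.aemeasurable]
  have hm9 : ∀ i, Measurable fun u : ℝ => ∫⁻ S, F ((u, i), S) ∂ν := fun i =>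
    hm8.comp (measurable_id.prodMk measurable_const)
  simp only [markLaw, lintegral_add_measure, lintegral_smul_measure, lintegral_dirac, smul_eq_mul]
  rw [lintegral_add_left ((hm9 _).const_mul _), lintegral_const_mul _ (hm9 _),
    lintegral_const_mul _ (hm9 _)]

end Exponential

end DualQueue

/-! ### The merged stream of deliveries on a fixed realisation -/

namespace DualQueue

/-- Time between the `n`-th and the `n+1`-st delivery, obsolete updates included. -/
noncomputable def gaps (S : Sensor → ℕ → ℝ) (n : ℕ) : ℝ := gap (residual^[n] S)

/-- Sensor of the `n+1`-st delivery, obsolete updates included. -/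
noncomputable def marks (S : Sensor → ℕ → ℝ) (n : ℕ) : Sensor := nextSensor (residual^[n] S)

/-- Time of the `n`-th delivery. -/
noncomputable def epoch (e : ℕ → ℝ) (n : ℕ) : ℝ := ∑ k ∈ Finset.range n, e k

/-- The `n`-th delivery comes from the other sensor than the preceding one. -/
def Switch (j : ℕ → Sensor) : ℕ → Prop
  | 0 => False
  | 1 => False
  | n + 2 => j (n + 1) ≠ j n

/-- The `n`-th delivery is a successful reception. -/
def Accepted (a₀ : ℝ) (j : ℕ → Sensor) : ℕ → Prop
  | 0 => False
  | 1 => 0 < a₀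
  | n + 2 => Switch j (n + 2) → Switch j (n + 1)

instance (j : ℕ → Sensor) : DecidablePred (Switch j) := fun n =>
  match n with
  | 0 => isFalse id
  | 1 => isFalse id
  | n + 2 => inferInstanceAs (Decidable (j (n + 1) ≠ j n))

/-- Age of information just after the `n`-th delivery. -/
noncomputable def headAge (a₀ : ℝ) (e : ℕ → ℝ) (j : ℕ → Sensor) : ℕ → ℝ
  | 0 => a₀
  | n + 1 => e n + if Switch j (n + 1) then e (n - 1) else 0

/-- Number of deliveries of sensor `i` among the first `n` ones. -/
def count (j : ℕ → Sensor) : ℕ → Sensor → ℕ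
  | 0, _ => 0
  | n + 1, i => count j n i + if j n = i then 1 else 0

/-- Index of the last delivery of sensor `i` among the first `n` ones, `0` if there is none. -/
def lastIndex (j : ℕ → Sensor) : ℕ → Sensor → ℕ
  | 0, _ => 0
  | n + 1, i => if j n = i then n + 1 else lastIndex j n i

/-- The realisations for which no two deliveries are simultaneous. -/
structure Regular (S : Sensor → ℕ → ℝ) : Prop where
  pos : ∀ i k, 0 < S i k
  ne : ∀ n, (residual^[n] S) Sensor.A 0 ≠ (residual^[n] S) Sensor.B 0
  div : Tendsto (epoch (gaps S)) atTop atTop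

theorem epoch_succ (e : ℕ → ℝ) (n : ℕ) : epoch e (n + 1) = epoch e n + e n :=
  Finset.sum_range_succ _ _

theorem epoch_zero (e : ℕ → ℝ) : epoch e 0 = 0 := rfl

theorem strictMono_epoch {e : ℕ → ℝ} (he : ∀ n, 0 < e n) : StrictMono (epoch e) :=
  strictMono_nat_of_lt_succ fun n => by rw [epoch_succ]; linarith [he n]

theorem genTime_succ (S : Sensor → ℕ → ℝ) (i : Sensor) (k : ℕ) :
    genTime S i (k + 1) = delTime S i k := Finset.sum_range_succ _ _

theorem residual_apply (S : Sensor → ℕ → ℝ) (i : Sensor) (k : ℕ) :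
    residual S i k = if nextSensor S = i then S i (k + 1)
      else if k = 0 then S i 0 - gap S else S i k := by
  by_cases h : S Sensor.A 0 < S Sensor.B 0 <;> cases i <;> cases k <;>
    simp [residual, nextSensor, gap, h, push, dropFirst]

/-- The dictionary between the iterated residual system and the original clocks: after `n` merged
deliveries the head of `i` is the remaining time of its service in progress, and the later services
are those not yet begun. -/
theorem residual_iterate (S : Sensor → ℕ → ℝ) (n : ℕ) (i : Sensor) (k : ℕ) :
    (residual^[n] S) i k = if k = 0 then delTime S i (count (marks S) n i) - epoch (gaps S) n
      else S i (count (marks S) n i + k) := by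
  induction n generalizing i k with
  | zero => 
    cases k <;> simp [count, epoch, delTime, genTime]
  | succ n ih =>
    rw [Function.iterate_succ_apply', residual_apply, epoch_succ]
    change (if marks S n = i then _ else if k = 0 then _ - gaps S n else _) = _
    by_cases h : marks S n = i
    · have hg : gaps S n = delTime S i (count (marks S) n i) - epoch (gaps S) n := by
        have := ih i 0
        rw [if_pos rfl] at this
        rw [← this, ← h]; rfl
      rw [if_pos h, ih, if_neg (by omega), count, if_pos h]
      cases k with
      | zero => rw [if_pos rfl, hg, delTime, genTime_succ]; ring
      | succ k => rw [if_neg (by omega)]; congr 1; ring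
    · rw [if_neg h, ih, ih, count, if_neg h]
      cases k with
      | zero => simp only [if_true]; ring_nf
      | succ k => simp

theorem residual_pos {S : Sensor → ℕ → ℝ} (hpos : ∀ i k, 0 < S i k)
    (hne : S Sensor.A 0 ≠ S Sensor.B 0) (i : Sensor) (k : ℕ) : 0 < residual S i k := by
  rcases lt_or_gt_of_ne hne with h | h
  · cases i <;> cases k <;>
      simp [residual_apply, nextSensor, gap, h, hpos]
  · cases i <;> cases k <;>
      simp [residual_apply, nextSensor, gap, h, hpos, not_lt.2 h.le]

theorem epoch_gaps_succ (S : Sensor → ℕ → ℝ) (n : ℕ) :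
    epoch (gaps S) (n + 1) = delTime S (marks S n) (count (marks S) n (marks S n)) := by
  have := residual_iterate S n (marks S n) 0
  rw [if_pos rfl] at this
  have h2 : gaps S n = (residual^[n] S) (marks S n) 0 := rfl
  rw [epoch_succ, h2, this]; ring

/-- A sensor submits an update at its own last delivery. The default `lastIndex = 0` is right as
well, since the first updates are submitted at `epoch 0 = 0`. -/
theorem genTime_count (S : Sensor → ℕ → ℝ) (n : ℕ) (i : Sensor) :
    genTime S i (count (marks S) n i) = epoch (gaps S) (lastIndex (marks S) n i) := by
  induction n with
  | zero => simp [count, lastIndex, genTime, epoch]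
  | succ n ih =>
    by_cases hj : marks S n = i
    · rw [count, lastIndex, if_pos hj, if_pos hj, genTime_succ, epoch_gaps_succ, hj]
    · rw [count, lastIndex, if_neg hj, if_neg hj, add_zero, ih]

namespace Regular

variable {S : Sensor → ℕ → ℝ} (hS : Regular S)
include hS

theorem iterate_pos (n : ℕ) (i : Sensor) (k : ℕ) : 0 < (residual^[n] S) i k := by
  induction n generalizing i k with
  | zero => exact hS.pos i k
  | succ n ih =>
    rw [Function.iterate_succ_apply']
    exact residual_pos ih (hS.ne n) i k

theorem gaps_pos (n : ℕ) : 0 < gaps S n := hS.iterate_pos n _ 0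

theorem epoch_strictMono : StrictMono (epoch (gaps S)) := strictMono_epoch hS.gaps_pos

theorem epoch_lt (n : ℕ) (i : Sensor) :
    epoch (gaps S) n < delTime S i (count (marks S) n i) := by
  have := residual_iterate S n i 0
  rw [if_pos rfl] at this
  have h2 := hS.iterate_pos n i 0
  linarith

theorem epoch_succ_le (n : ℕ) (i : Sensor) :
    epoch (gaps S) (n + 1) ≤ delTime S i (count (marks S) n i) := by
  by_cases h : marks S n = i
  · rw [← h, epoch_gaps_succ]
  · have := (hS.epoch_lt (n + 1) i).le
    rwa [count, if_neg h] at this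

theorem genTime_strictMono (i : Sensor) : StrictMono (genTime S i) :=
  strictMono_nat_of_lt_succ fun n => by rw [genTime_succ, delTime]; linarith [hS.pos i n]

theorem delTime_strictMono (i : Sensor) : StrictMono (delTime S i) := fun a c h => by
  rw [← genTime_succ, ← genTime_succ]; exact hS.genTime_strictMono i (by omega)

theorem delTime_le_epoch (n : ℕ) (i : Sensor) (k : ℕ) (hk : k < count (marks S) n i) :
    delTime S i k ≤ epoch (gaps S) n := by
  induction n with
  | zero => simp [count] at hk
  | succ n ih =>
    rcases lt_or_ge k (count (marks S) n i) with h | h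
    · exact (ih h).trans (hS.epoch_strictMono.monotone (by omega))
    · by_cases hj : marks S n = i
      · rw [count, if_pos hj] at hk
        have : k = count (marks S) n i := by omega
        rw [epoch_gaps_succ, this, ← hj]
      · rw [count, if_neg hj] at hk; omega

theorem delTime_le_iff {n : ℕ} {t : ℝ} (h1 : epoch (gaps S) n ≤ t) (h2 : t < epoch (gaps S) (n + 1))
    (i : Sensor) (k : ℕ) : delTime S i k ≤ t ↔ k < count (marks S) n i := by
  constructor
  · intro h
    by_contra hcon
    have := (hS.epoch_succ_le n i).trans ((hS.delTime_strictMono i).monotone (not_lt.1 hcon))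
    linarith
  · intro h; exact (hS.delTime_le_epoch n i k h).trans h1

theorem delTime_lt_iff (n : ℕ) (i : Sensor) (k : ℕ) :
    delTime S i k < epoch (gaps S) (n + 1) ↔ k < count (marks S) n i := by
  constructor
  · intro h
    by_contra hcon
    have := (hS.epoch_succ_le n i).trans ((hS.delTime_strictMono i).monotone (not_lt.1 hcon))
    linarith
  · intro h
    exact (hS.delTime_le_epoch n i k h).trans_lt (hS.epoch_strictMono (by omega))

/-- As the epochs diverge, the number of deliveries of `i` must exceed `k` at some point; the
delivery at which it first does so is the one sought. -/
theorem exists_delivery (i : Sensor) (k : ℕ) :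
    ∃ n, marks S n = i ∧ count (marks S) n i = k := by
  have hex : ∃ n, k < count (marks S) n i := by
    obtain ⟨n, hn⟩ := (hS.div.eventually_gt_atTop (delTime S i k)).exists
    refine ⟨n, ?_⟩
    by_contra hcon
    have := (hS.epoch_lt n i).trans_le ((hS.delTime_strictMono i).monotone (not_lt.1 hcon))
    linarith
  classical
  have h1 := Nat.find_spec hex
  have h2 : ∀ m, m < Nat.find hex → ¬ k < count (marks S) m i := fun m hm => Nat.find_min hex hm
  generalize Nat.find hex = n at h1 h2
  cases n with
  | zero => simp [count] at h1
  | succ n =>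
    have h3 := h2 n (by omega)
    rw [count] at h1
    by_cases hj : marks S n = i
    · rw [if_pos hj] at h1; exact ⟨n, hj, by omega⟩
    · rw [if_neg hj] at h1; omega

end Regular

theorem lastIndex_le (j : ℕ → Sensor) (n : ℕ) (i : Sensor) : lastIndex j n i ≤ n := by
  induction n with
  | zero => simp [lastIndex]
  | succ n ih => rw [lastIndex]; split_ifs <;> omega

/-- Generation time of the freshest update among the first `n` deliveries. -/
noncomputable def best (a₀ : ℝ) (S : Sensor → ℕ → ℝ) : ℕ → ℝ
  | 0 => -a₀
  | n + 1 => max (best a₀ S n) (genTime S (marks S n) (count (marks S) n (marks S n)))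

/-- Between two epochs the supremum in `freshest` runs over a finite set, so it is a maximum that
can be updated one delivery at a time. -/
theorem isGreatest_best (a₀ : ℝ) (S : Sensor → ℕ → ℝ) (n : ℕ) :
    IsGreatest ({-a₀} ∪ {g | ∃ i k, k < count (marks S) n i ∧ g = genTime S i k}) (best a₀ S n) := by
  induction n with
  | zero => 
    refine ⟨Or.inl rfl, ?_⟩
    rintro g (hg | ⟨i, k, hk, -⟩)
    · exact le_of_eq hg
    · simp [count] at hk
  | succ n ih =>
    constructor
    · rw [best]
      rcases max_choice (best a₀ S n) (genTime S (marks S n) (count (marks S) n (marks S n)))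
        with h | h
      · rw [h]
        rcases ih.1 with h1 | ⟨i, k, hk, hg⟩
        · exact Or.inl h1
        · exact Or.inr ⟨i, k, by rw [count]; omega, hg⟩
      · rw [h]
        exact Or.inr ⟨_, _, by rw [count, if_pos rfl]; omega, rfl⟩
    · rintro g (hg | ⟨i, k, hk, rfl⟩)
      · exact (ih.2 (Or.inl hg)).trans (le_max_left _ _)
      · rcases lt_or_ge k (count (marks S) n i) with h | h
        · exact (ih.2 (Or.inr ⟨i, k, h, rfl⟩)).trans (le_max_left _ _)
        · by_cases hj : marks S n = i
          · rw [count, if_pos hj] at hk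
            have hk' : k = count (marks S) n i := by omega
            rw [hk', ← hj]
            exact le_max_right _ _
          · rw [count, if_neg hj] at hk; omega

namespace Regular

variable {S : Sensor → ℕ → ℝ} (hS : Regular S) {a₀ : ℝ}
include hS

theorem freshest_eq {n : ℕ} {t : ℝ} (h1 : epoch (gaps S) n ≤ t)
    (h2 : t < epoch (gaps S) (n + 1)) : freshest a₀ S t = best a₀ S n := by
  rw [freshest]
  simp only [hS.delTime_le_iff h1 h2]
  exact (isGreatest_best a₀ S n).csSup_eq

/-- Without a switch, the delivered update was generated at the preceding delivery, which no other
received update can beat. With a switch, neither of the last two updates was generated after the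
delivery before them, and since there are only two sensors one of them was generated exactly then.
-/
theorem best_succ (ha : 0 ≤ a₀) (n : ℕ) : best a₀ S (n + 1)
    = epoch (gaps S) (if Switch (marks S) (n + 1) then n - 1 else n) := by
  induction n with
  | zero =>
    simp [best, count, genTime, epoch, ha]
  | succ n ih =>
    rw [best, ih, genTime_count, lastIndex]
    have hmono := hS.epoch_strictMono.monotone
    by_cases hj : marks S n = marks S (n + 1)
    · have hs : ¬ Switch (marks S) (n + 1 + 1) := fun h => h hj.symm
      rw [if_pos hj, if_neg hs]
      exact max_eq_right (hmono (by split_ifs <;> omega))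
    · have hs : Switch (marks S) (n + 1 + 1) := fun h => hj h.symm
      rw [if_neg hj, if_pos hs, Nat.add_sub_cancel]
      -- Two switches in a row return to the sensor of delivery `n`, so the new update was generated
      -- at that delivery. If only the last delivery is a switch, the new update is no fresher than
      -- the previous one and the maximum stays.
      by_cases hs' : Switch (marks S) (n + 1)
      · rw [if_pos hs']
        cases n with
        | zero => exact absurd hs' id
        | succ n =>
          have h1 : marks S (n + 1) ≠ marks S n := hs'
          have h2 : marks S n = marks S (n + 1 + 1) := by
            cases h3 : marks S n <;> cases h4 : marks S (n + 1) <;>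
              cases h5 : marks S (n + 1 + 1) <;> simp_all
          rw [lastIndex, if_pos h2]
          exact max_eq_right (hmono (by omega))
      · rw [if_neg hs']
        exact max_eq_left (hmono (lastIndex_le _ _ _))

theorem best_eq (ha : 0 ≤ a₀) (n : ℕ) :
    best a₀ S n = epoch (gaps S) n - headAge a₀ (gaps S) (marks S) n := by
  cases n with
  | zero => simp [best, epoch, headAge]
  | succ n =>
    rw [hS.best_succ ha, headAge, epoch_succ]
    split_ifs with h
    · cases n with
      | zero => exact absurd h id
      | succ n => rw [epoch_succ, Nat.add_sub_cancel]; ring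
    · ring

/-- Epochs increase strictly, so by `best_succ` only indices are compared; from the second delivery
on they coincide exactly for a switch preceded by a non-switch. At the first delivery the comparison
is `-a₀ < 0`. -/
theorem best_lt_iff (ha : 0 ≤ a₀) (n : ℕ) :
    best a₀ S n < best a₀ S (n + 1) ↔ Accepted a₀ (marks S) (n + 1) := by
  cases n with
  | zero =>
    rw [hS.best_succ ha]
    simp [best, epoch, Accepted]
  | succ n =>
    rw [hS.best_succ ha, hS.best_succ ha, hS.epoch_strictMono.lt_iff_lt, Accepted]
    split_ifs with h1 h2 h2
    · have : n ≠ 0 := by rintro rfl; exact h1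
      simp only [h1, implies_true, iff_true]; omega
    · simp only [h1, h2, implies_true, iff_true]; omega
    · simp [h1, h2]
    · simp [h1, h2]

/-- `IsFresh` asks the new generation time to exceed every member of the set whose greatest element
is `best a₀ S n`. -/
theorem isFresh_iff (n : ℕ) :
    IsFresh a₀ S (marks S n) (count (marks S) n (marks S n)) ↔ best a₀ S n < best a₀ S (n + 1) := by
  rw [IsFresh, ← epoch_gaps_succ]
  simp only [hS.delTime_lt_iff]
  rw [best, lt_max_iff, or_iff_right (lt_irrefl _)]
  constructor
  · rintro ⟨h1, h2⟩
    rcases (isGreatest_best a₀ S n).1 with h | ⟨i, k, hk, hg⟩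
    · rw [show best a₀ S n = -a₀ from h]; exact h1
    · rw [hg]; exact h2 i k hk
  · intro h
    exact ⟨((isGreatest_best a₀ S n).2 (Or.inl rfl)).trans_lt h, fun i k hk =>
      ((isGreatest_best a₀ S n).2 (Or.inr ⟨i, k, hk, rfl⟩)).trans_lt h⟩

theorem refreshSet_eq (ha : 0 ≤ a₀) :
    refreshSet a₀ S = {t | ∃ n, Accepted a₀ (marks S) n ∧ t = epoch (gaps S) n} := by
  ext t
  constructor
  · rintro ⟨i, k, hf, rfl⟩
    obtain ⟨n, rfl, rfl⟩ := hS.exists_delivery i k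
    exact ⟨n + 1, (hS.best_lt_iff ha n).1 ((hS.isFresh_iff n).1 hf), (epoch_gaps_succ S n).symm⟩
  · rintro ⟨n, hn, rfl⟩
    cases n with
    | zero => exact absurd hn id
    | succ n =>
      exact ⟨_, _, (hS.isFresh_iff n).2 ((hS.best_lt_iff ha n).2 hn), (epoch_gaps_succ S n).symm⟩

/-- A successfully received update and its service time. -/
theorem exists_isFresh (ha : 0 ≤ a₀) {n : ℕ} (hn : Accepted a₀ (marks S) n) :
    ∃ i k, IsFresh a₀ S i k ∧ delTime S i k = epoch (gaps S) n
      ∧ S i k = headAge a₀ (gaps S) (marks S) n := by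
  cases n with
  | zero => exact absurd hn id
  | succ n =>
    have h1 := (hS.best_lt_iff ha n).2 hn
    refine ⟨_, _, (hS.isFresh_iff n).2 h1, (epoch_gaps_succ S n).symm, ?_⟩
    have h2 := hS.best_eq ha (n + 1)
    rw [epoch_gaps_succ] at h2
    have h3 : best a₀ S (n + 1) = genTime S (marks S n) (count (marks S) n (marks S n)) := by
      rw [best] at h1 ⊢
      rw [lt_max_iff, or_iff_right (lt_irrefl _)] at h1
      exact max_eq_right h1.le
    rw [h3, delTime] at h2
    linarith

theorem aoi_eq (ha : 0 ≤ a₀) {n : ℕ} {t : ℝ} (h1 : epoch (gaps S) n ≤ t)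
    (h2 : t < epoch (gaps S) (n + 1)) :
    aoi a₀ S t = headAge a₀ (gaps S) (marks S) n + (t - epoch (gaps S) n) := by
  rw [aoi, hS.freshest_eq h1 h2, hS.best_eq ha]; ring

end Regular

end DualQueue

/-! ### Enumeration of the successful receptions -/

namespace DualQueue

/-- The delivery after the `m`-th one is obsolete. -/
def Skip (j : ℕ → Sensor) (m : ℕ) : Prop := ¬ Switch j m ∧ Switch j (m + 1)

instance (j : ℕ → Sensor) : DecidablePred (Skip j) := fun m =>
  inferInstanceAs (Decidable (¬ Switch j m ∧ Switch j (m + 1)))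

/-- Indices of deliveries, obsolete deliveries being omitted after the first one. -/
def acceptedIndex (j : ℕ → Sensor) : ℕ → ℕ
  | 0 => 1
  | n + 1 => acceptedIndex j n + 1 + if Skip j (acceptedIndex j n) then 1 else 0

open Classical in
/-- Index of the `n`-th successful reception among all deliveries. -/
noncomputable def refreshIndex (a₀ : ℝ) (j : ℕ → Sensor) : ℕ → ℕ
  | 0 => 0
  | n + 1 => acceptedIndex j (if 0 < a₀ then n else n + 1)

theorem accepted_succ_iff {a₀ : ℝ} {j : ℕ → Sensor} {m : ℕ} (hm : 1 ≤ m) :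
    Accepted a₀ j (m + 1) ↔ ¬ Skip j m := by
  obtain ⟨m, rfl⟩ : ∃ k, m = k + 1 := ⟨m - 1, by omega⟩
  simp only [Accepted, Skip]; tauto

/-- An obsolete delivery is itself a switch, so the next one cannot be obsolete: at most one
delivery is omitted at a time. -/
theorem not_skip_succ {j : ℕ → Sensor} {m : ℕ} (h : Skip j m) : ¬ Skip j (m + 1) :=
  fun h' => h'.1 h.2

theorem one_le_acceptedIndex (j : ℕ → Sensor) (n : ℕ) : n + 1 ≤ acceptedIndex j n := by
  induction n with
  | zero => exact le_rfl
  | succ n ih => rw [acceptedIndex]; omega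

theorem acceptedIndex_le (j : ℕ → Sensor) (n : ℕ) : acceptedIndex j n ≤ 2 * n + 1 := by
  induction n with
  | zero => exact le_rfl
  | succ n ih => rw [acceptedIndex]; split_ifs <;> omega

theorem accepted_acceptedIndex_succ (a₀ : ℝ) (j : ℕ → Sensor) (n : ℕ) :
    Accepted a₀ j (acceptedIndex j (n + 1)) := by
  have h1 := one_le_acceptedIndex j n
  rw [acceptedIndex]
  split_ifs with h
  · rw [accepted_succ_iff (by omega)]; exact not_skip_succ h
  · rw [add_zero, accepted_succ_iff (by omega)]; exact h

theorem not_accepted_between {a₀ : ℝ} {j : ℕ → Sensor} {n m : ℕ} (h1 : acceptedIndex j n < m)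
    (h2 : m < acceptedIndex j (n + 1)) : ¬ Accepted a₀ j m := by
  have h0 := one_le_acceptedIndex j n
  rw [acceptedIndex] at h2
  split_ifs at h2 with h
  · have : m = acceptedIndex j n + 1 := by omega
    rw [this, accepted_succ_iff (by omega)]; exact not_not.2 h
  · omega

theorem accepted_refreshIndex_succ (a₀ : ℝ) (j : ℕ → Sensor) (n : ℕ) :
    Accepted a₀ j (refreshIndex a₀ j (n + 1)) := by
  rw [refreshIndex]
  split_ifs with h
  · cases n with
    | zero => exact h
    | succ n => exact accepted_acceptedIndex_succ _ _ _
  · exact accepted_acceptedIndex_succ _ _ _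

theorem refreshIndex_lt_succ (a₀ : ℝ) (j : ℕ → Sensor) (n : ℕ) :
    refreshIndex a₀ j n < refreshIndex a₀ j (n + 1) := by
  cases n with
  | zero => rw [refreshIndex, refreshIndex]; have := one_le_acceptedIndex j; split_ifs <;> grind
  | succ n => 
    rw [refreshIndex, refreshIndex]
    split_ifs <;> (conv_rhs => rw [acceptedIndex]) <;> omega

/-- The increment is at most two except at the start: if `0 < a₀` fails, the first delivery is not a
reception, and the second is obsolete too when it comes from the other sensor. -/
theorem refreshIndex_succ_le (a₀ : ℝ) (j : ℕ → Sensor) (n : ℕ) :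
    refreshIndex a₀ j (n + 1) ≤ refreshIndex a₀ j n + 3 := by
  cases n with
  | zero => 
    rw [refreshIndex, refreshIndex]
    split_ifs
    · exact (acceptedIndex_le j 0).trans (by omega)
    · exact acceptedIndex_le j 1
  | succ n => 
    rw [refreshIndex, refreshIndex]
    split_ifs <;> (conv_lhs => rw [acceptedIndex]) <;> split_ifs <;> omega

theorem refreshIndex_strictMono (a₀ : ℝ) (j : ℕ → Sensor) : StrictMono (refreshIndex a₀ j) :=
  strictMono_nat_of_lt_succ (refreshIndex_lt_succ a₀ j)

theorem refreshIndex_le (a₀ : ℝ) (j : ℕ → Sensor) (n : ℕ) : refreshIndex a₀ j n ≤ 3 * n := by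
  induction n with
  | zero => exact le_rfl
  | succ n ih => have := refreshIndex_succ_le a₀ j n; omega

theorem not_accepted_refreshIndex {a₀ : ℝ} {j : ℕ → Sensor} {n m : ℕ}
    (h1 : refreshIndex a₀ j n < m) (h2 : m < refreshIndex a₀ j (n + 1)) : ¬ Accepted a₀ j m := by
  cases n with
  | zero =>
    rw [refreshIndex] at h1
    rw [refreshIndex] at h2
    split_ifs at h2 with h
    · rw [acceptedIndex] at h2; omega
    · rcases Nat.lt_or_ge 1 m with hm | hm
      · exact not_accepted_between (n := 0) hm h2
      · have : m = 1 := by omega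
        rw [this]; exact h
  | succ n =>
    rw [refreshIndex] at h1 h2
    split_ifs at h1 h2 with h
    · exact not_accepted_between h1 h2
    · exact not_accepted_between h1 h2

theorem exists_refreshIndex_eq {a₀ : ℝ} {j : ℕ → Sensor} {m : ℕ} (hm : Accepted a₀ j m) :
    ∃ n, refreshIndex a₀ j (n + 1) = m := by
  have hex : ∃ n, m ≤ refreshIndex a₀ j n := ⟨m, (refreshIndex_strictMono a₀ j).le_apply⟩
  classical
  have h1 := Nat.find_spec hex
  have h2 : ∀ k, k < Nat.find hex → ¬ m ≤ refreshIndex a₀ j k := fun k hk => Nat.find_min hex hk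
  generalize Nat.find hex = n at h1 h2
  cases n with
  | zero =>
    rw [refreshIndex, Nat.le_zero] at h1
    rw [h1] at hm
    exact absurd hm id
  | succ n =>
    refine ⟨n, ?_⟩
    by_contra hne
    exact not_accepted_refreshIndex (not_le.1 (h2 n (by omega))) (lt_of_le_of_ne h1 (Ne.symm hne)) hm

/-- An increasing unbounded sequence of times splits the half-line. -/
theorem exists_index_of_strictMono {b : ℕ → ℝ} (hb : StrictMono b) (hb' : Tendsto b atTop atTop) :
    ∃ N : ℝ → ℕ, Tendsto N atTop atTop ∧ ∀ τ, b 0 < τ → b (N τ) < τ ∧ τ ≤ b (N τ + 1) := by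
  classical
  have hex : ∀ τ, ∃ n, τ ≤ b n := fun τ => (hb'.eventually_ge_atTop τ).exists
  refine ⟨fun τ => Nat.find (hex τ) - 1, ?_, ?_⟩
  · refine tendsto_atTop.2 fun m => ?_
    filter_upwards [eventually_gt_atTop (b m)] with τ hτ
    have : m < Nat.find (hex τ) := by
      rw [Nat.lt_find_iff]
      intro k hk
      exact not_le.2 ((hb.monotone hk).trans_lt hτ)
    omega
  · intro τ hτ
    beta_reduce
    have h1 := Nat.find_spec (hex τ)
    have h2 : ∀ k, k < Nat.find (hex τ) → ¬ τ ≤ b k := fun k hk => Nat.find_min (hex τ) hk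
    generalize Nat.find (hex τ) = n at h1 h2
    cases n with
    | zero => exact absurd h1 (not_le.2 hτ)
    | succ n =>
      exact ⟨not_le.1 (h2 n (by omega)), h1⟩

/-- Averages of a monotone function along a sequence of times with asymptotically linear growth. -/
theorem tendsto_div_of_monotoneOn {A : ℝ → ℝ} (hA : MonotoneOn A (Set.Ici 0)) (hA0 : A 0 = 0)
    {b : ℕ → ℝ} (hb : StrictMono b) (hb0 : 0 < b 0) {β γ : ℝ} (hβ : 0 < β)
    (h1 : Tendsto (fun n : ℕ => b n / n) atTop (𝓝 β))
    (h2 : Tendsto (fun n : ℕ => A (b n) / n) atTop (𝓝 γ)) :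
    Tendsto (fun τ => A τ / τ) atTop (𝓝 (γ / β)) := by
  have hbpos : ∀ n, 0 < b n := fun n => hb0.trans_le (hb.monotone (Nat.zero_le n))
  have hApos : ∀ x, 0 ≤ x → 0 ≤ A x := fun x hx => by
    rw [← hA0]; exact hA (Set.mem_Ici.2 le_rfl) hx hx
  have hb' : Tendsto b atTop atTop := by
    have := h1.pos_mul_atTop hβ (tendsto_natCast_atTop_atTop (R := ℝ))
    refine this.congr' ?_
    filter_upwards [eventually_gt_atTop 0] with n hn
    have : (n : ℝ) ≠ 0 := by positivity
    field_simp
  obtain ⟨N, hN, hN'⟩ := exists_index_of_strictMono hb hb'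
  have hratio : Tendsto (fun n : ℕ => ((n : ℝ) + 1) / n) atTop (𝓝 1) := by
    have := tendsto_const_nhds (x := (1 : ℝ)).add (tendsto_one_div_atTop_nhds_zero_nat (𝕜 := ℝ))
    rw [add_zero] at this
    refine this.congr' ?_
    filter_upwards [eventually_gt_atTop 0] with n hn
    have : (n : ℝ) ≠ 0 := by positivity
    field_simp
  have hshift : ∀ {u : ℕ → ℝ} {l : ℝ}, Tendsto (fun n : ℕ => u n / n) atTop (𝓝 l) →
      Tendsto (fun n : ℕ => u (n + 1) / n) atTop (𝓝 l) := by
    intro u l hu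
    have h3 := ((tendsto_add_atTop_iff_nat 1).2 hu).mul hratio
    rw [mul_one] at h3
    refine h3.congr' ?_
    filter_upwards [eventually_gt_atTop 0] with n hn
    have : (n : ℝ) ≠ 0 := by positivity
    push_cast
    field_simp
  -- For `b n < τ ≤ b (n + 1)`, monotonicity squeezes `A τ / τ` between `A (b n) / b (n + 1)` and `A
  -- (b (n + 1)) / b n`; both have the limit `γ / β`.
  have hlow : Tendsto (fun n : ℕ => A (b n) / b (n + 1)) atTop (𝓝 (γ / β)) := by
    refine (h2.div (hshift h1) hβ.ne').congr' ?_
    filter_upwards [eventually_gt_atTop 0] with n hn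
    have : (n : ℝ) ≠ 0 := by positivity
    simp only [Pi.div_apply]
    rw [div_div_div_cancel_right₀ this]
  have hup : Tendsto (fun n : ℕ => A (b (n + 1)) / b n) atTop (𝓝 (γ / β)) := by
    refine ((hshift (u := fun n => A (b n)) h2).div h1 hβ.ne').congr' ?_
    filter_upwards [eventually_gt_atTop 0] with n hn
    have : (n : ℝ) ≠ 0 := by positivity
    simp only [Pi.div_apply]
    rw [div_div_div_cancel_right₀ this]
  refine tendsto_of_tendsto_of_tendsto_of_le_of_le' (hlow.comp hN) (hup.comp hN) ?_ ?_
  · filter_upwards [eventually_gt_atTop (b 0)] with τ hτ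
    obtain ⟨h3, h4⟩ := hN' τ hτ
    have hτ0 : 0 < τ := hb0.trans hτ
    exact div_le_div₀ (hApos τ hτ0.le) (hA (hbpos _).le hτ0.le h3.le) hτ0 h4
  · filter_upwards [eventually_gt_atTop (b 0)] with τ hτ
    obtain ⟨h3, h4⟩ := hN' τ hτ
    have hτ0 : 0 < τ := hb0.trans hτ
    exact div_le_div₀ (hApos _ (hbpos _).le) (hA hτ0.le (hbpos _).le h4) (hbpos _) h3.le

theorem integral_add_sub (h a b : ℝ) :
    ∫ t in a..b, (h + (t - a)) = h * (b - a) + (b - a) ^ 2 / 2 := by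
  rw [intervalIntegral.integral_add (by simp) (Continuous.intervalIntegrable (by fun_prop) _ _),
    intervalIntegral.integral_sub (Continuous.intervalIntegrable (by fun_prop) _ _) (by simp)]
  simp only [intervalIntegral.integral_const, integral_id, smul_eq_mul]
  ring

theorem headAge_nonneg {a₀ : ℝ} (ha : 0 ≤ a₀) {e : ℕ → ℝ} (he : ∀ n, 0 ≤ e n) (j : ℕ → Sensor)
    (n : ℕ) : 0 ≤ headAge a₀ e j n := by
  cases n with
  | zero => exact ha
  | succ n =>
    rw [headAge]
    have := he n
    have := he (n - 1)
    split_ifs <;> linarith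

/-! ### Areas, reception times and long-run averages on a fixed realisation -/

namespace Regular

variable {S : Sensor → ℕ → ℝ} (hS : Regular S) {a₀ : ℝ}
include hS

theorem refreshTime_eq (ha : 0 ≤ a₀) (n : ℕ) :
    refreshTime a₀ S n = epoch (gaps S) (refreshIndex a₀ (marks S) n) := by
  induction n with
  | zero => rw [refreshTime, refreshIndex, epoch_zero]
  | succ n ih =>
    rw [refreshTime]
    refine IsLeast.csInf_eq ⟨⟨?_, ?_⟩, ?_⟩
    · rw [hS.refreshSet_eq ha]
      exact ⟨_, accepted_refreshIndex_succ _ _ _, rfl⟩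
    · rw [ih]; exact hS.epoch_strictMono (refreshIndex_lt_succ _ _ _)
    · rintro t ⟨ht, ht'⟩
      rw [hS.refreshSet_eq ha] at ht
      obtain ⟨m, hm, rfl⟩ := ht
      rw [ih, hS.epoch_strictMono.lt_iff_lt] at ht'
      refine hS.epoch_strictMono.monotone ?_
      by_contra hcon
      exact not_accepted_refreshIndex ht' (not_le.1 hcon) hm

theorem interArrival_succ (ha : 0 ≤ a₀) (n : ℕ) : interArrival a₀ S (n + 1)
    = epoch (gaps S) (refreshIndex a₀ (marks S) (n + 1))
      - epoch (gaps S) (refreshIndex a₀ (marks S) n) := by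
  rw [interArrival, hS.refreshTime_eq ha, hS.refreshTime_eq ha, Nat.add_sub_cancel]

theorem aoi_eq_of_not_accepted (ha : 0 ≤ a₀) {f g : ℕ} (hfg : ∀ m, f < m → m < g →
    ¬ Accepted a₀ (marks S) m) {t : ℝ} (h1 : epoch (gaps S) f ≤ t) (h2 : t < epoch (gaps S) g) :
    aoi a₀ S t = headAge a₀ (gaps S) (marks S) f + (t - epoch (gaps S) f) := by
  -- Deliveries that are not receptions leave `best` unchanged, so the age grows with slope one all
  -- the way from `f` to `g`.
  have hbest : ∀ d, f + d < g → best a₀ S (f + d) = best a₀ S f := by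
    intro d
    induction d with
    | zero => intro _; rfl
    | succ d ih =>
      intro hd
      rw [← ih (by omega)]
      refine le_antisymm ?_ (le_max_left _ _)
      by_contra hcon
      exact hfg (f + d + 1) (by omega) hd ((hS.best_lt_iff ha _).1 (not_le.1 hcon))
  have hex : ∃ n, t < epoch (gaps S) n := ⟨g, h2⟩
  classical
  have h3 := Nat.find_spec hex
  have h4 : ∀ k, k < Nat.find hex → ¬ t < epoch (gaps S) k := fun k hk => Nat.find_min hex hk
  have h5 : Nat.find hex ≤ g := Nat.find_min' hex h2
  generalize Nat.find hex = n at h3 h4 h5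
  have hfn : f < n := by
    by_contra hcon
    have := hS.epoch_strictMono.monotone (not_lt.1 hcon)
    linarith
  obtain ⟨d, rfl⟩ : ∃ d, n = f + d + 1 := ⟨n - f - 1, by omega⟩
  rw [aoi, hS.freshest_eq (not_lt.1 (h4 (f + d) (by omega))) h3, hbest d (by omega), hS.best_eq ha]
  ring

theorem integral_aoi_of_not_accepted (ha : 0 ≤ a₀) {f g : ℕ} (hle : f ≤ g)
    (hfg : ∀ m, f < m → m < g → ¬ Accepted a₀ (marks S) m) :
    ∫ t in (epoch (gaps S) f)..(epoch (gaps S) g), aoi a₀ S t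
      = headAge a₀ (gaps S) (marks S) f * (epoch (gaps S) g - epoch (gaps S) f)
        + (epoch (gaps S) g - epoch (gaps S) f) ^ 2 / 2 := by
  rw [← integral_add_sub]
  have hle' := hS.epoch_strictMono.monotone hle
  -- The age may drop at the right endpoint, so the integrands are compared on the open interval
  -- only.
  rw [intervalIntegral.integral_of_le hle', intervalIntegral.integral_of_le hle',
    integral_Ioc_eq_integral_Ioo, integral_Ioc_eq_integral_Ioo]
  refine setIntegral_congr_fun measurableSet_Ioo fun t ht => ?_
  exact hS.aoi_eq_of_not_accepted ha hfg ht.1.le ht.2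

theorem area_succ (ha : 0 ≤ a₀) (n : ℕ) : area a₀ S (n + 1)
    = headAge a₀ (gaps S) (marks S) (refreshIndex a₀ (marks S) n) * interArrival a₀ S (n + 1)
      + interArrival a₀ S (n + 1) ^ 2 / 2 := by
  rw [area, Nat.add_sub_cancel, hS.interArrival_succ ha, hS.refreshTime_eq ha,
    hS.refreshTime_eq ha]
  exact hS.integral_aoi_of_not_accepted ha (refreshIndex_lt_succ _ _ _).le
    fun m h1 h2 => not_accepted_refreshIndex h1 h2

theorem integral_aoi_epoch_succ (ha : 0 ≤ a₀) (n : ℕ) :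
    ∫ t in (epoch (gaps S) n)..(epoch (gaps S) (n + 1)), aoi a₀ S t
      = headAge a₀ (gaps S) (marks S) n * gaps S n + gaps S n ^ 2 / 2 := by
  rw [hS.integral_aoi_of_not_accepted ha (Nat.le_succ n) (fun m h1 h2 => by omega), epoch_succ,
    add_sub_cancel_left]

theorem intervalIntegrable_aoi_epoch (ha : 0 ≤ a₀) (n : ℕ) :
    IntervalIntegrable (aoi a₀ S) volume 0 (epoch (gaps S) n) := by
  rw [← epoch_zero (gaps S)]
  refine IntervalIntegrable.trans_iterate fun k _ => ?_
  have hc : IntervalIntegrable (fun t => headAge a₀ (gaps S) (marks S) k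
      + (t - epoch (gaps S) k)) volume (epoch (gaps S) k) (epoch (gaps S) (k + 1)) :=
    Continuous.intervalIntegrable (by fun_prop) _ _
  have hle' := hS.epoch_strictMono.monotone (Nat.le_succ k)
  rw [intervalIntegrable_iff_integrableOn_Ioo_of_le hle'] at hc ⊢
  exact hc.congr_fun (fun t ht => (hS.aoi_eq ha ht.1.le ht.2).symm) measurableSet_Ioo

theorem intervalIntegrable_aoi (ha : 0 ≤ a₀) {x y : ℝ} (hx : 0 ≤ x) (hy : 0 ≤ y) :
    IntervalIntegrable (aoi a₀ S) volume x y := by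
  obtain ⟨n, hn⟩ := (hS.div.eventually_ge_atTop (max x y)).exists
  refine (hS.intervalIntegrable_aoi_epoch ha n).mono_set ?_
  have h1 := le_max_left x y
  have h2 := le_max_right x y
  rw [Set.uIcc_of_le (le_trans (hx.trans h1) hn)]
  exact Set.uIcc_subset_Icc ⟨hx, h1.trans hn⟩ ⟨hy, h2.trans hn⟩

theorem aoi_nonneg (ha : 0 ≤ a₀) {t : ℝ} (ht : 0 ≤ t) : 0 ≤ aoi a₀ S t := by
  obtain ⟨n, hn⟩ := (hS.div.eventually_gt_atTop t).exists
  have hex : ∃ n, t < epoch (gaps S) n := ⟨n, hn⟩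
  classical
  have h3 := Nat.find_spec hex
  have h4 : ∀ k, k < Nat.find hex → ¬ t < epoch (gaps S) k := fun k hk => Nat.find_min hex hk
  generalize Nat.find hex = n at h3 h4
  cases n with
  | zero => rw [epoch_zero] at h3; linarith
  | succ n =>
    have h5 := not_lt.1 (h4 n (by omega))
    rw [hS.aoi_eq ha h5 h3]
    have := headAge_nonneg ha (fun n => (hS.gaps_pos n).le) (marks S) n
    linarith

theorem monotoneOn_integral_aoi (ha : 0 ≤ a₀) :
    MonotoneOn (fun τ => ∫ t in (0 : ℝ)..τ, aoi a₀ S t) (Set.Ici 0) := by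
  intro x hx y hy hxy
  have hx' : (0 : ℝ) ≤ x := hx
  have h := intervalIntegral.integral_add_adjacent_intervals
    (hS.intervalIntegrable_aoi ha le_rfl hx) (hS.intervalIntegrable_aoi ha hx hy)
  have h2 : 0 ≤ ∫ t in x..y, aoi a₀ S t := intervalIntegral.integral_nonneg hxy fun t ht =>
    hS.aoi_nonneg ha (hx'.trans ht.1)
  simp only
  linarith

theorem integral_aoi_epoch (ha : 0 ≤ a₀) (n : ℕ) :
    ∫ t in (0 : ℝ)..(epoch (gaps S) n), aoi a₀ S t
      = ∑ k ∈ Finset.range n, (headAge a₀ (gaps S) (marks S) k * gaps S k + gaps S k ^ 2 / 2) := by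
  induction n with
  | zero => simp [epoch_zero]
  | succ n ih =>
    have hp : ∀ m, 0 ≤ epoch (gaps S) m := fun m => by
      rw [← epoch_zero (gaps S)]; exact hS.epoch_strictMono.monotone (Nat.zero_le m)
    rw [← intervalIntegral.integral_add_adjacent_intervals
      (hS.intervalIntegrable_aoi ha le_rfl (hp n)) (hS.intervalIntegrable_aoi ha (hp n) (hp (n + 1))),
      ih, hS.integral_aoi_epoch_succ ha, Finset.sum_range_succ]

theorem sum_area (ha : 0 ≤ a₀) (N : ℕ) : ∑ n ∈ Finset.Icc 1 N, area a₀ S n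
    = ∫ t in (0 : ℝ)..(epoch (gaps S) (refreshIndex a₀ (marks S) N)), aoi a₀ S t := by
  induction N with
  | zero => simp [refreshIndex, epoch_zero]
  | succ N ih =>
    have hp : ∀ m, 0 ≤ epoch (gaps S) m := fun m => by
      rw [← epoch_zero (gaps S)]; exact hS.epoch_strictMono.monotone (Nat.zero_le m)
    rw [Finset.sum_Icc_succ_top (by omega), ih, area, Nat.add_sub_cancel, hS.refreshTime_eq ha,
      hS.refreshTime_eq ha]
    exact intervalIntegral.integral_add_adjacent_intervals
      (hS.intervalIntegrable_aoi ha le_rfl (hp _)) (hS.intervalIntegrable_aoi ha (hp _) (hp _))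

/-- A reception exactly at `τ` is not counted, which is why the left inequality is strict and the
right one is not. -/
theorem numRefresh_eq (ha : 0 ≤ a₀) {N : ℕ} {τ : ℝ}
    (h1 : epoch (gaps S) (refreshIndex a₀ (marks S) N) < τ)
    (h2 : τ ≤ epoch (gaps S) (refreshIndex a₀ (marks S) (N + 1))) : numRefresh a₀ S τ = N := by
  have hmono : StrictMono fun n => epoch (gaps S) (refreshIndex a₀ (marks S) n) :=
    hS.epoch_strictMono.comp (refreshIndex_strictMono a₀ (marks S))
  have hset : refreshSet a₀ S ∩ Set.Ioo 0 τ
      = (fun n => epoch (gaps S) (refreshIndex a₀ (marks S) n)) '' (Finset.Icc 1 N : Finset ℕ) := by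
    rw [hS.refreshSet_eq ha]
    ext t
    constructor
    · rintro ⟨⟨m, hm, rfl⟩, h3⟩
      obtain ⟨n, rfl⟩ := exists_refreshIndex_eq hm
      refine ⟨n + 1, ?_, rfl⟩
      have := hmono.lt_iff_lt.1 (h3.2.trans_le h2)
      simp only [Finset.coe_Icc, Set.mem_Icc]; omega
    · rintro ⟨n, hn, rfl⟩
      simp only [Finset.coe_Icc, Set.mem_Icc] at hn
      obtain ⟨k, rfl⟩ : ∃ k, n = k + 1 := ⟨n - 1, by omega⟩
      refine ⟨⟨_, accepted_refreshIndex_succ _ _ _, rfl⟩, ?_, ?_⟩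
      · have := hmono (Nat.succ_pos k)
        simp only [refreshIndex, epoch_zero] at this
        exact this
      · exact (hmono.monotone hn.2).trans_lt h1
  rw [numRefresh, hset, Set.ncard_image_of_injective _ hmono.injective, Set.ncard_coe_finset,
    Nat.card_Icc]
  omega

/-- Here `g` is the mean gap and `c` the mean area per delivery. The subsequence `3 * n + 2` suits
the strong law for blocks of three deliveries, with two initial terms set apart; the factor 3
cancels in the quotient. -/
theorem tendsto_timeAvgAoI (ha : 0 ≤ a₀) {g c : ℝ} (hg : 0 < g)
    (h1 : Tendsto (fun n : ℕ => epoch (gaps S) n / n) atTop (𝓝 g))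
    (h2 : Tendsto (fun n : ℕ => (∑ k ∈ Finset.range (3 * n + 2),
      (headAge a₀ (gaps S) (marks S) k * gaps S k + gaps S k ^ 2 / 2)) / (n : ℝ))
      atTop (𝓝 (3 * c))) :
    Tendsto (fun τ : ℝ => timeAvgAoI a₀ S τ) atTop (𝓝 (c / g)) := by
  have hb : StrictMono fun n : ℕ => epoch (gaps S) (3 * n + 2) :=
    hS.epoch_strictMono.comp fun a b h => by omega
  have hb0 : 0 < epoch (gaps S) (3 * 0 + 2) := by
    have := hS.epoch_strictMono (show 0 < 3 * 0 + 2 by omega)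
    rwa [epoch_zero] at this
  have ht : Tendsto (fun n : ℕ => 3 * n + 2) atTop atTop :=
    tendsto_atTop_mono (fun n => by simp only [id]; omega) tendsto_id
  have hr : Tendsto (fun n : ℕ => (3 * (n : ℝ) + 2) / n) atTop (𝓝 3) := by
    have := tendsto_const_nhds (x := (3 : ℝ)).add ((tendsto_const_nhds (x := (2 : ℝ))).mul
      (tendsto_one_div_atTop_nhds_zero_nat (𝕜 := ℝ)))
    rw [mul_zero, add_zero] at this
    refine this.congr' ?_
    filter_upwards [eventually_gt_atTop 0] with n hn
    have : (n : ℝ) ≠ 0 := by positivity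
    field_simp
  have h3 : Tendsto (fun n : ℕ => epoch (gaps S) (3 * n + 2) / n) atTop (𝓝 (3 * g)) := by
    have := (h1.comp ht).mul hr
    rw [mul_comm g] at this
    refine this.congr' ?_
    filter_upwards [eventually_gt_atTop 0] with n hn
    have : (n : ℝ) ≠ 0 := by positivity
    have : (3 * (n : ℝ) + 2) ≠ 0 := by positivity
    simp only [Function.comp]
    push_cast
    field_simp
  have := tendsto_div_of_monotoneOn (hS.monotoneOn_integral_aoi ha) (by simp) hb hb0
    (by positivity) h3 (γ := 3 * c) (h2.congr fun n => by rw [hS.integral_aoi_epoch ha])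
  rw [mul_div_mul_left _ _ (by norm_num : (3 : ℝ) ≠ 0)] at this
  refine this.congr fun τ => ?_
  rw [timeAvgAoI, one_div_mul_eq_div]

/-- The areas add up to the integral until the last reception `R (N τ)`. Hence the area average at
`τ` is the age average at `R (N τ)` times `R (N τ) / τ`, and this factor tends to 1. -/
theorem tendsto_timeAvgArea (ha : 0 ≤ a₀) {g l : ℝ} (hg : 0 < g)
    (h1 : Tendsto (fun n : ℕ => epoch (gaps S) n / n) atTop (𝓝 g))
    (h2 : Tendsto (fun τ : ℝ => timeAvgAoI a₀ S τ) atTop (𝓝 l)) :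
    Tendsto (fun τ : ℝ => timeAvgArea a₀ S τ) atTop (𝓝 l) := by
  set R : ℕ → ℝ := fun n => epoch (gaps S) (refreshIndex a₀ (marks S) n) with hR
  have hmono : StrictMono R := hS.epoch_strictMono.comp (refreshIndex_strictMono a₀ (marks S))
  have hR0 : R 0 = 0 := by simp [hR, refreshIndex, epoch_zero]
  have hidx := (refreshIndex_strictMono a₀ (marks S)).tendsto_atTop
  have hRdiv : Tendsto R atTop atTop := hS.div.comp hidx
  obtain ⟨N, hN, hN'⟩ := exists_index_of_strictMono hmono hRdiv
  -- The next reception is at most three deliveries away, so this ratio bounds `R (N τ) / τ` from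
  -- below.
  have hratio : Tendsto (fun m : ℕ => epoch (gaps S) m / epoch (gaps S) (m + 3)) atTop (𝓝 1) := by
    have h3 := (tendsto_add_atTop_iff_nat 3).2 h1
    have hr : Tendsto (fun n : ℕ => ((n : ℝ) / (n + 3))) atTop (𝓝 1) := by
      simpa using tendsto_natCast_div_add_atTop (𝕜 := ℝ) 3
    have h4 := (h1.div h3 hg.ne').mul hr
    rw [div_self hg.ne', mul_one] at h4
    refine h4.congr' ?_
    filter_upwards [eventually_gt_atTop 0] with n hn
    have h5 : (n : ℝ) ≠ 0 := by positivity
    have h6 : ((n : ℝ) + 3) ≠ 0 := by positivity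
    have h7 : epoch (gaps S) (n + 3) ≠ 0 := by
      have := hS.epoch_strictMono (show 0 < n + 3 by omega)
      rw [epoch_zero] at this; exact this.ne'
    simp only [Pi.div_apply]
    push_cast
    field_simp
  have hone : Tendsto (fun τ => R (N τ) / τ) atTop (𝓝 1) := by
    refine tendsto_of_tendsto_of_tendsto_of_le_of_le' (hratio.comp (hidx.comp hN))
      tendsto_const_nhds ?_ ?_
    · filter_upwards [eventually_gt_atTop 0] with τ hτ
      obtain ⟨h3, h4⟩ := hN' τ (by rw [hR0]; exact hτ)
      have h5 : 0 ≤ R (N τ) := by rw [← hR0]; exact hmono.monotone (Nat.zero_le _)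
      refine div_le_div_of_nonneg_left h5 hτ (h4.trans ?_)
      exact hS.epoch_strictMono.monotone (refreshIndex_succ_le _ _ _)
    · filter_upwards [eventually_gt_atTop 0] with τ hτ
      obtain ⟨h3, h4⟩ := hN' τ (by rw [hR0]; exact hτ)
      exact (div_le_one hτ).2 h3.le
  have h3 := hone.mul (h2.comp (hRdiv.comp hN))
  rw [one_mul] at h3
  refine h3.congr' ?_
  filter_upwards [eventually_gt_atTop 0, hN.eventually_gt_atTop 0] with τ hτ hNτ
  obtain ⟨h4, h5⟩ := hN' τ (by rw [hR0]; exact hτ)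
  have h6 : R (N τ) ≠ 0 := by
    have := hmono hNτ
    rw [hR0] at this; exact this.ne'
  rw [timeAvgArea, hS.numRefresh_eq ha h4 h5, hS.sum_area ha]
  simp only [Function.comp, timeAvgAoI]
  field_simp
  rfl

end Regular

end DualQueue

/-! ### Moments, independence and strong law for the merged stream -/

namespace DualQueue

open scoped ENNReal

section Moments

theorem integrable_pow_expMeasure {r : ℝ} (hr : 0 < r) (n : ℕ) :
    Integrable (fun x => x ^ n) (expMeasure r) := by
  rw [expMeasure_eq, integrable_withDensity_iff (measurable_exponentialPDF r)
    (Eventually.of_forall fun x => ENNReal.ofReal_lt_top)]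
  have h := integrableOn_rpow_mul_exp_neg_mul_rpow (s := n) (p := 1) (b := r)
    (by have : (0 : ℝ) ≤ n := Nat.cast_nonneg n
        linarith) one_pos hr
  rw [← integrableOn_Ici_iff_integrableOn_Ioi, ← integrable_indicator_iff measurableSet_Ici] at h
  refine (h.mul_const r).congr (Eventually.of_forall fun x => ?_)
  by_cases hx : 0 ≤ x
  · simp only [Set.indicator_of_mem (Set.mem_Ici.2 hx), exponentialPDF_of_nonneg hx, Real.rpow_one,
      Real.rpow_natCast]
    rw [ENNReal.toReal_ofReal (by positivity)]
    ring_nf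
  · simp only [Set.indicator_of_notMem (s := Set.Ici (0 : ℝ)) (by simpa using hx),
      exponentialPDF_of_neg (not_le.1 hx)]
    simp

theorem integral_pow_expMeasure {r : ℝ} (hr : 0 < r) (n : ℕ) :
    ∫ x, x ^ n ∂(expMeasure r) = n.factorial / r ^ n := by
  rw [expMeasure_eq, integral_withDensity_eq_integral_toReal_smul (measurable_exponentialPDF r)
    (Eventually.of_forall fun x => ENNReal.ofReal_lt_top)]
  have h := Real.integral_rpow_mul_exp_neg_mul_Ioi (a := n + 1) (r := r) (by positivity) hr
  rw [Real.Gamma_nat_eq_factorial] at h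
  have h2 : ∫ x, (exponentialPDF r x).toReal • x ^ n
      = ∫ x, (Set.Ici (0 : ℝ)).indicator (fun t => r * (t ^ ((n : ℝ) + 1 - 1)
        * Real.exp (-(r * t)))) x := by
    refine integral_congr_ae (Eventually.of_forall fun x => ?_)
    by_cases hx : 0 ≤ x
    · simp only [Set.indicator_of_mem (Set.mem_Ici.2 hx), exponentialPDF_of_nonneg hx,
        add_sub_cancel_right, Real.rpow_natCast, smul_eq_mul]
      rw [ENNReal.toReal_ofReal (by positivity)]
      ring
    · simp only [Set.indicator_of_notMem (s := Set.Ici (0 : ℝ)) (by simpa using hx),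
        exponentialPDF_of_neg (not_le.1 hx)]
      simp
  rw [h2, integral_indicator measurableSet_Ici, integral_Ici_eq_integral_Ioi, integral_const_mul, h]
  rw [show ((n : ℝ) + 1) = ((n + 1 : ℕ) : ℝ) by push_cast; ring, Real.rpow_natCast,
    one_div, inv_pow, pow_succ]
  field_simp

end Moments

/-- Two independent variables form an independent family. -/
theorem iIndepFun_bool {Ω : Type*} [MeasurableSpace Ω] {P : Measure Ω} [IsProbabilityMeasure P]
    {X : Bool → Ω → ℝ} (h : IndepFun (X true) (X false) P) : iIndepFun X P := by
  rw [iIndepFun_iff_measure_inter_preimage_eq_mul]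
  have key : ∀ s : Finset Bool, s = ∅ ∨ s = {true} ∨ s = {false} ∨ s = {true, false} := by decide
  intro s B hB
  rcases key s with rfl | rfl | rfl | rfl
  · simp
  · simp
  · simp
  · have := (indepFun_iff_measure_inter_preimage_eq_mul.1 h) (B true) (B false)
      (hB true (by simp)) (hB false (by simp))
    rw [Finset.set_biInter_insert, Finset.set_biInter_singleton, this,
      Finset.prod_pair (by decide)]

section Stationary

variable {μ : Sensor → ℝ}

/-- Law of the service times of the M-M system. -/
noncomputable def mmLaw (μ : Sensor → ℝ) : Measure (Sensor → ℕ → ℝ) :=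
  serviceLaw fun i => expMeasure (μ i)

theorem isProbabilityMeasure_mmLaw (hμ : ∀ i, 0 < μ i) : IsProbabilityMeasure (mmLaw μ) := by
  have : ∀ i, IsProbabilityMeasure (expMeasure (μ i)) :=
    fun i => isProbabilityMeasure_expMeasure (hμ i)
  unfold mmLaw; infer_instance

theorem measurable_gaps_apply (n : ℕ) : Measurable fun S => gaps S n :=
  measurable_gap.comp (measurable_residual.iterate n)

theorem measurable_marks_apply (n : ℕ) : Measurable fun S => marks S n :=
  measurable_nextSensor.comp (measurable_residual.iterate n)

theorem measurable_gaps : Measurable gaps := measurable_pi_iff.2 measurable_gaps_apply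

theorem measurable_marks : Measurable marks := measurable_pi_iff.2 measurable_marks_apply

theorem gaps_residual_iterate (S : Sensor → ℕ → ℝ) (m n : ℕ) :
    gaps (residual^[m] S) n = gaps S (n + m) := by
  rw [gaps, gaps, Function.iterate_add_apply]

theorem marks_residual_iterate (S : Sensor → ℕ → ℝ) (m n : ℕ) :
    marks (residual^[m] S) n = marks S (n + m) := by
  rw [marks, marks, Function.iterate_add_apply]

variable (hμ : ∀ i, 0 < μ i)
include hμ

theorem iIndepFun_gaps_marks : iIndepFun (fun n S => (gaps S n, marks S n)) (mmLaw μ) := by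
  have := isProbabilityMeasure_mmLaw hμ
  have := isProbabilityMeasure_markLaw hμ
  have := isProbabilityMeasure_expMeasure (add_pos (hμ Sensor.A) (hμ Sensor.B))
  exact iIndepFun_iterates (measurable_gap.prodMk measurable_nextSensor) measurable_residual
    (map_gap_residual hμ)

theorem measurePreserving_residual : MeasurePreserving residual (mmLaw μ) (mmLaw μ) := by
  have := isProbabilityMeasure_mmLaw hμ
  have := isProbabilityMeasure_markLaw hμ
  have := isProbabilityMeasure_expMeasure (add_pos (hμ Sensor.A) (hμ Sensor.B))
  exact measurePreserving_tail (measurable_gap.prodMk measurable_nextSensor) measurable_residual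
    (map_gap_residual hμ)

theorem map_gap_nextSensor : (mmLaw μ).map (fun S => (gap S, nextSensor S))
    = (expMeasure (μ Sensor.A + μ Sensor.B)).prod (markLaw μ) := by
  have := isProbabilityMeasure_mmLaw hμ
  exact map_head (measurable_gap.prodMk measurable_nextSensor) measurable_residual
    (map_gap_residual hμ)

theorem map_gaps_marks (n : ℕ) : (mmLaw μ).map (fun S => (gaps S n, marks S n))
    = (expMeasure (μ Sensor.A + μ Sensor.B)).prod (markLaw μ) := by
  rw [← map_gap_nextSensor hμ, ← ((measurePreserving_residual hμ).iterate n).map_eq,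
    Measure.map_map (measurable_gap.prodMk measurable_nextSensor)
      ((measurePreserving_residual hμ).iterate n).measurable,
    ((measurePreserving_residual hμ).iterate n).map_eq]
  rfl

theorem map_gaps (n : ℕ) : (mmLaw μ).map (fun S => gaps S n)
    = expMeasure (μ Sensor.A + μ Sensor.B) := by
  have := isProbabilityMeasure_markLaw hμ
  have h := congrArg (Measure.map Prod.fst) (map_gaps_marks hμ n)
  rwa [Measure.map_map measurable_fst ((measurable_gaps_apply n).prodMk (measurable_marks_apply n)),
    Measure.map_fst_prod, measure_univ, one_smul] at h

theorem map_marks (n : ℕ) : (mmLaw μ).map (fun S => marks S n) = markLaw μ := by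
  have := isProbabilityMeasure_markLaw hμ
  have := isProbabilityMeasure_expMeasure (add_pos (hμ Sensor.A) (hμ Sensor.B))
  have h := congrArg (Measure.map Prod.snd) (map_gaps_marks hμ n)
  rwa [Measure.map_map measurable_snd ((measurable_gaps_apply n).prodMk (measurable_marks_apply n)),
    Measure.map_snd_prod, measure_univ, one_smul] at h

theorem indepFun_gap_mark (n : ℕ) :
    IndepFun (fun S => gaps S n) (fun S => marks S n) (mmLaw μ) := by
  have := isProbabilityMeasure_mmLaw hμ
  rw [indepFun_iff_map_prod_eq_prod_map_map (measurable_gaps_apply n).aemeasurable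
    (measurable_marks_apply n).aemeasurable, map_gaps_marks hμ, map_gaps hμ, map_marks hμ]

/-- The delivery times of the merged stream are independent of the delivering sensors. -/
theorem indepFun_gaps_marks : IndepFun gaps marks (mmLaw μ) := by
  have := isProbabilityMeasure_mmLaw hμ
  -- Marks are coded as reals so that gaps and marks form one real family indexed by `ℕ × Bool`.
  -- Independence over `n` and within each pair makes the whole family independent, and then gaps
  -- and marks are disjoint subfamilies.
  let code : Sensor → ℝ := fun i => if i = Sensor.A then 1 else 0
  let decode : ℝ → Sensor := fun x => if x = 1 then Sensor.A else Sensor.B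
  have hcode : Measurable code := measurable_from_top
  have hdecode : Measurable decode :=
    Measurable.ite (measurableSet_singleton (1 : ℝ)) measurable_const measurable_const
  have hdc : ∀ i, decode (code i) = i := by intro i; cases i <;> simp [code, decode]
  let X : ℕ → Bool → (Sensor → ℕ → ℝ) → ℝ := fun n b S => if b then gaps S n else code (marks S n)
  have hX : ∀ n b, Measurable (X n b) := by
    intro n b
    cases b
    · simpa [X, Function.comp_def] using hcode.comp (measurable_marks_apply n)
    · simpa [X] using measurable_gaps_apply n
  have h1 : iIndepFun (fun n S => (X n · S)) (mmLaw μ) := by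
    refine (iIndepFun_gaps_marks hμ).comp
      (fun _ (z : ℝ × Sensor) (b : Bool) => if b then z.1 else code z.2) fun n => ?_
    refine measurable_pi_iff.2 fun b => ?_
    cases b
    · simpa [Function.comp_def] using hcode.comp (measurable_snd (α := ℝ) (β := Sensor))
    · simpa using measurable_fst
  have h2 : ∀ n, iIndepFun (X n) (mmLaw μ) := fun n => iIndepFun_bool (by
    simpa [X, Function.comp_def] using (indepFun_gap_mark hμ n).comp measurable_id hcode)
  have h3 := iIndepFun_uncurry' hX h1 h2
  have h4 := indepFun_subfamilies (fun p => hX p.1 p.2) h3 (fun n : ℕ => (n, true))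
    (fun n : ℕ => (n, false)) (by simp)
  have hψ : Measurable fun (x : ℕ → ℝ) n => decode (x n) :=
    measurable_pi_iff.2 fun n => hdecode.comp (measurable_pi_apply n)
  have h5 := h4.comp (φ := id) measurable_id hψ
  have h6 : marks = (fun x n => decode (x n)) ∘ fun S n => X (n, false).1 (n, false).2 S := by
    funext S n
    simp [X, hdc]
  rw [h6]
  exact h5

theorem iIndepFun_gaps : iIndepFun (fun n S => gaps S n) (mmLaw μ) :=
  (iIndepFun_gaps_marks hμ).comp (fun _ z => z.1) fun _ => measurable_fst

theorem iIndepFun_marks : iIndepFun (fun n S => marks S n) (mmLaw μ) :=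
  (iIndepFun_gaps_marks hμ).comp (fun _ z => z.2) fun _ => measurable_snd

theorem integrable_gaps_pow (n k : ℕ) : Integrable (fun S => gaps S n ^ k) (mmLaw μ) := by
  have h := integrable_pow_expMeasure (add_pos (hμ Sensor.A) (hμ Sensor.B)) k
  rw [← map_gaps hμ n] at h
  exact h.comp_measurable (measurable_gaps_apply n)

theorem integral_gaps_pow (n k : ℕ) :
    ∫ S, gaps S n ^ k ∂(mmLaw μ) = k.factorial / (μ Sensor.A + μ Sensor.B) ^ k := by
  rw [← integral_pow_expMeasure (add_pos (hμ Sensor.A) (hμ Sensor.B)) k, ← map_gaps hμ n,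
    integral_map (measurable_gaps_apply n).aemeasurable (by fun_prop)]

theorem integrable_gaps (n : ℕ) : Integrable (fun S => gaps S n) (mmLaw μ) := by
  simpa using integrable_gaps_pow hμ n 1

theorem integral_gaps (n : ℕ) : ∫ S, gaps S n ∂(mmLaw μ) = 1 / (μ Sensor.A + μ Sensor.B) := by
  simpa using integral_gaps_pow hμ n 1

theorem memLp_gaps (n : ℕ) : MemLp (fun S => gaps S n) 2 (mmLaw μ) :=
  (memLp_two_iff_integrable_sq (measurable_gaps_apply n).aestronglyMeasurable).2
    (integrable_gaps_pow hμ n 2)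

theorem integrable_gaps_mul (m n : ℕ) : Integrable (fun S => gaps S m * gaps S n) (mmLaw μ) :=
  (memLp_gaps hμ m).integrable_mul (memLp_gaps hμ n)

theorem integral_gaps_mul {m n : ℕ} (hmn : m ≠ n) :
    ∫ S, gaps S m * gaps S n ∂(mmLaw μ) = 1 / (μ Sensor.A + μ Sensor.B) ^ 2 := by
  have h := ((iIndepFun_gaps hμ).indepFun hmn).integral_mul_eq_mul_integral
    (measurable_gaps_apply m).aestronglyMeasurable (measurable_gaps_apply n).aestronglyMeasurable
  have h' : ∫ S, gaps S m * gaps S n ∂(mmLaw μ)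
    = (∫ S, gaps S m ∂(mmLaw μ)) * ∫ S, gaps S n ∂(mmLaw μ) := h
  rw [h', integral_gaps hμ, integral_gaps hμ, one_div_mul_one_div, sq]

theorem measure_marks (n : ℕ) (i : Sensor) :
    (mmLaw μ).real {S | marks S n = i} = μ i / (μ Sensor.A + μ Sensor.B) := by
  have hA := hμ Sensor.A
  have hB := hμ Sensor.B
  have h : (mmLaw μ) {S | marks S n = i} = markLaw μ {i} := by
    rw [← map_marks hμ n, Measure.map_apply (measurable_marks_apply n) trivial]; rfl
  rw [measureReal_def, h, markLaw]
  cases i <;> simp <;> positivity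

/-- Strong law for a function of a block of the merged stream, along every `p`-th block. -/
theorem ae_tendsto_block (p r : ℕ) {G : (Fin p → ℝ × Sensor) → ℝ}
    (hG : Measurable G)
    (hint : Integrable (fun S => G fun a => (gaps S a, marks S a)) (mmLaw μ)) :
    ∀ᵐ S ∂(mmLaw μ), Tendsto (fun N : ℕ => (∑ n ∈ Finset.range N,
      G fun a => (gaps S (a + (p * n + r)), marks S (a + (p * n + r)))) / (N : ℝ)) atTop
      (𝓝 (∫ S, G (fun a => (gaps S a, marks S a)) ∂(mmLaw μ))) := by
  have := isProbabilityMeasure_mmLaw hμ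
  let V : ℕ → (Sensor → ℕ → ℝ) → ℝ := fun n S =>
    G fun a => (gaps S (a + (p * n + r)), marks S (a + (p * n + r)))
  have hV0 : Measurable fun S : Sensor → ℕ → ℝ => G fun a : Fin p => (gaps S a, marks S a) :=
    hG.comp (measurable_pi_iff.2 fun a => (measurable_gaps_apply a).prodMk (measurable_marks_apply a))
  have hVeq : ∀ n, V n = (fun S => G fun a => (gaps S a, marks S a)) ∘ residual^[p * n + r] := by
    intro n; funext S
    simp only [V, Function.comp, gaps_residual_iterate, marks_residual_iterate]
  have hmp := fun n => (measurePreserving_residual hμ).iterate n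
  have hid0 : ∀ n, IdentDistrib (V n) (fun S => G fun a => (gaps S a, marks S a)) (mmLaw μ)
      (mmLaw μ) := by
    intro n
    refine ⟨?_, hV0.aemeasurable, ?_⟩
    · rw [hVeq]; exact (hV0.comp (hmp _).measurable).aemeasurable
    · rw [hVeq, ← Measure.map_map hV0 (hmp _).measurable, (hmp _).map_eq]
  -- Blocks of length `p` starting at `p * n + r` are disjoint for different `n`.
  have hind : Pairwise (Function.onFun (fun f g => IndepFun f g (mmLaw μ)) V) := by
    intro n n' hne
    have h := indepFun_subfamilies
      (fun k => (measurable_gaps_apply k).prodMk (measurable_marks_apply k))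
      (iIndepFun_gaps_marks hμ) (fun a : Fin p => (a : ℕ) + (p * n + r))
      (fun a : Fin p => (a : ℕ) + (p * n' + r)) (by
        intro a c hac
        have ha := a.2
        have hc := c.2
        rcases lt_or_gt_of_ne hne with h | h
        · have : p * (n + 1) ≤ p * n' := Nat.mul_le_mul_left p h
          rw [Nat.mul_succ] at this; omega
        · have : p * (n' + 1) ≤ p * n := Nat.mul_le_mul_left p h
          rw [Nat.mul_succ] at this; omega)
    exact h.comp hG hG
  have h := strong_law_ae_real V ((hid0 0).integrable_iff.2 hint) hind
    fun n => (hid0 n).trans (hid0 0).symm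
  filter_upwards [h] with S hSt
  rwa [(hid0 0).integral_eq] at hSt

theorem ae_tendsto_epoch : ∀ᵐ S ∂(mmLaw μ),
    Tendsto (fun n : ℕ => epoch (gaps S) n / n) atTop (𝓝 (1 / (μ Sensor.A + μ Sensor.B))) := by
  have hint : Integrable (fun S => gaps S 0) (mmLaw μ) := integrable_gaps hμ 0
  have h := ae_tendsto_block hμ 1 0 (G := fun x => (x 0).1)
    (measurable_fst.comp (measurable_pi_apply 0)) hint
  filter_upwards [h] with S hSt
  have h2 : ∫ S, gaps S ((0 : Fin 1) : ℕ) ∂(mmLaw μ) = 1 / (μ Sensor.A + μ Sensor.B) :=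
    integral_gaps hμ 0
  simp only [h2] at hSt
  refine hSt.congr fun n => ?_
  simp [epoch]

/-- A tie between two independent atomless clocks is a null event, and it stays null at every later
delivery because `residual` preserves the law. The epochs diverge by the strong law. -/
theorem ae_regular : ∀ᵐ S ∂(mmLaw μ), Regular S := by
  have hP := isProbabilityMeasure_mmLaw hμ
  have hpi : ∀ i, IsProbabilityMeasure (expMeasure (μ i)) :=
    fun i => isProbabilityMeasure_expMeasure (hμ i)
  have h1 : ∀ᵐ S ∂(mmLaw μ), ∀ i k, 0 < S i k := by
    rw [ae_all_iff]; intro i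
    rw [ae_all_iff]; intro k
    have h := ae_expMeasure_pos (μ i)
    rw [← map_eval_serviceLaw (m := fun i => expMeasure (μ i)) i k] at h
    exact ae_of_ae_map (measurable_serviceTime i k).aemeasurable h
  have h2 : ∀ᵐ S ∂(mmLaw μ), S Sensor.A 0 ≠ S Sensor.B 0 := by
    have hind : IndepFun (fun S : Sensor → ℕ → ℝ => S Sensor.A 0) (fun S => S Sensor.B 0)
        (mmLaw μ) := (iIndepFun_serviceLaw (m := fun i => expMeasure (μ i))).indepFun
          (i := (Sensor.A, 0)) (j := (Sensor.B, 0)) (by simp)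
    have hmap := (indepFun_iff_map_prod_eq_prod_map_map
      (measurable_serviceTime Sensor.A 0).aemeasurable
      (measurable_serviceTime Sensor.B 0).aemeasurable).1 hind
    have hB : (mmLaw μ).map (fun S => S Sensor.B 0) = expMeasure (μ Sensor.B) :=
      map_eval_serviceLaw (m := fun i => expMeasure (μ i)) _ _
    have hA : (mmLaw μ).map (fun S => S Sensor.A 0) = expMeasure (μ Sensor.A) :=
      map_eval_serviceLaw (m := fun i => expMeasure (μ i)) _ _
    rw [hA, hB] at hmap
    have hnull : ∀ᵐ p ∂((expMeasure (μ Sensor.A)).prod (expMeasure (μ Sensor.B))), p.1 ≠ p.2 := by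
      rw [Measure.ae_prod_iff_ae_ae]
      · refine Eventually.of_forall fun x => ?_
        have := expMeasure_singleton (μ Sensor.B) x
        filter_upwards [measure_eq_zero_iff_ae_notMem.1 this] with y hy hxy
        exact hy hxy.symm
      · exact (measurableSet_eq_fun measurable_fst measurable_snd).compl
    rw [← hmap] at hnull
    exact ae_of_ae_map ((measurable_serviceTime _ _).prodMk
      (measurable_serviceTime _ _)).aemeasurable hnull
  have h3 : ∀ᵐ S ∂(mmLaw μ), ∀ n, (residual^[n] S) Sensor.A 0 ≠ (residual^[n] S) Sensor.B 0 := by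
    rw [ae_all_iff]; intro n
    exact ((measurePreserving_residual hμ).iterate n).quasiMeasurePreserving.ae h2
  filter_upwards [h1, h3, ae_tendsto_epoch hμ] with S hp hne hep
  refine ⟨hp, hne, ?_⟩
  have hs : 0 < 1 / (μ Sensor.A + μ Sensor.B) := by
    have hA := hμ Sensor.A
    have hB := hμ Sensor.B
    positivity
  have := hep.pos_mul_atTop hs (tendsto_natCast_atTop_atTop (R := ℝ))
  refine this.congr' ?_
  filter_upwards [eventually_gt_atTop 0] with n hn
  have : (n : ℝ) ≠ 0 := by positivity
  field_simp

end Stationary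

end DualQueue

/-! ### Gaps read at an index determined by the marks -/

namespace DualQueue

theorem measurableSet_switch (m : ℕ) : MeasurableSet {j : ℕ → Sensor | Switch j m} := by
  match m with
  | 0 => exact MeasurableSet.empty
  | 1 => exact MeasurableSet.empty
  | m + 2 =>
    exact (measurableSet_eq_fun (measurable_pi_apply (m + 1)) (measurable_pi_apply m)).compl

theorem measurableSet_skip (m : ℕ) : MeasurableSet {j : ℕ → Sensor | Skip j m} :=
  (measurableSet_switch m).compl.inter (measurableSet_switch (m + 1))

theorem measurableSet_randomIndex {α : Type*} [MeasurableSpace α] {p : α → ℕ → Prop}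
    (hp : ∀ m, MeasurableSet {x | p x m}) {f : α → ℕ} (hf : Measurable f) :
    MeasurableSet {x | p x (f x)} := by
  have : {x | p x (f x)} = ⋃ m, f ⁻¹' {m} ∩ {x | p x m} := by
    ext x; simp
  rw [this]
  exact MeasurableSet.iUnion fun m => (hf (measurableSet_singleton m)).inter (hp m)

theorem measurable_acceptedIndex (n : ℕ) : Measurable fun j => acceptedIndex j n := by
  induction n with
  | zero => exact measurable_const
  | succ n ih =>
    exact (ih.add_const 1).add (Measurable.ite (measurableSet_randomIndex measurableSet_skip ih)
      measurable_const measurable_const)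

section

variable {μ : Sensor → ℝ} (hμ : ∀ i, 0 < μ i) {D : Set (ℕ → Sensor)} (hD : MeasurableSet D)
  {f : (ℕ → Sensor) → ℕ} (hf : Measurable f) {N : ℕ} (hN : ∀ j, f j < N)
  {φ : ℕ → (ℕ → ℝ) → ℝ} (hφ : ∀ m, Measurable (φ m))
  (hint : ∀ m, Integrable (fun S => φ m (gaps S)) (mmLaw μ))

/-- Splitting by the value of the index turns the variable into a finite sum of products of a
function of the marks and a function of the gaps, where independence applies termwise. -/
theorem indicator_randomIndex_eq {N : ℕ} (hN : ∀ j, f j < N) :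
    (marks ⁻¹' D).indicator (fun S => φ (f (marks S)) (gaps S))
    = fun S => ∑ m ∈ Finset.range N,
        (D ∩ f ⁻¹' {m}).indicator (fun _ => (1 : ℝ)) (marks S) * φ m (gaps S) := by
  classical
  funext S
  simp only [Set.indicator_apply, Set.mem_inter_iff, Set.mem_preimage, Set.mem_singleton_iff]
  by_cases h : marks S ∈ D
  · simp [h, hN]
  · simp [h]

include hμ hD hf hN hφ hint

omit hφ in
theorem integrable_randomIndex : Integrable
    ((marks ⁻¹' D).indicator (fun S => φ (f (marks S)) (gaps S))) (mmLaw μ) := by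
  have := isProbabilityMeasure_mmLaw hμ
  rw [indicator_randomIndex_eq hN]
  refine integrable_finsetSum _ fun m _ => ?_
  have hDm : MeasurableSet (D ∩ f ⁻¹' {m}) := hD.inter (hf (measurableSet_singleton m))
  have hind : Measurable ((D ∩ f ⁻¹' {m}).indicator fun _ => (1 : ℝ)) :=
    measurable_const.indicator hDm
  refine (hint m).bdd_mul (c := 1) (hind.comp measurable_marks).aestronglyMeasurable
    (Eventually.of_forall fun S => ?_)
  refine (norm_indicator_le_norm_self _ _).trans (by simp)

/-- Mean of a function of the delivery times read at an index that is determined by the sensors. -/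
theorem integral_randomIndex {c : ℝ} (hc : ∀ j ∈ D, ∫ S, φ (f j) (gaps S) ∂(mmLaw μ) = c) :
    ∫ S, (marks ⁻¹' D).indicator (fun S => φ (f (marks S)) (gaps S)) S ∂(mmLaw μ)
      = c * (mmLaw μ).real (marks ⁻¹' D) := by
  have hP := isProbabilityMeasure_mmLaw hμ
  have hDm : ∀ m, MeasurableSet (D ∩ f ⁻¹' {m}) := fun m =>
    hD.inter (hf (measurableSet_singleton m))
  have hind : ∀ m, Measurable ((D ∩ f ⁻¹' {m}).indicator fun _ => (1 : ℝ)) := fun m =>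
    measurable_const.indicator (hDm m)
  have hone : ∀ m, ∫ S, (D ∩ f ⁻¹' {m}).indicator (fun _ => (1 : ℝ)) (marks S) ∂(mmLaw μ)
      = (mmLaw μ).real (marks ⁻¹' (D ∩ f ⁻¹' {m})) := by
    intro m
    rw [← integral_indicator_one (measurable_marks (hDm m))]
    rfl
  have hterm : ∀ m, ∫ S, (D ∩ f ⁻¹' {m}).indicator (fun _ => (1 : ℝ)) (marks S) * φ m (gaps S)
      ∂(mmLaw μ) = c * (mmLaw μ).real (marks ⁻¹' (D ∩ f ⁻¹' {m})) := by
    intro m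
    have h := ((indepFun_gaps_marks hμ).symm.comp (hind m) (hφ m)).integral_mul_eq_mul_integral
      ((hind m).comp measurable_marks).aestronglyMeasurable
      ((hφ m).comp measurable_gaps).aestronglyMeasurable
    refine Eq.trans h ?_
    simp only [Function.comp]
    rw [hone]
    -- The mean of `φ m` is known to be `c` only for values `m` that the index takes on `D`; the
    -- other terms carry an empty event.
    by_cases hne : ∃ j ∈ D, f j = m
    · obtain ⟨j, hj, rfl⟩ := hne
      rw [hc j hj, mul_comm]
    · have : D ∩ f ⁻¹' {m} = ∅ := by
        ext j
        simp only [Set.mem_inter_iff, Set.mem_preimage, Set.mem_singleton_iff,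
          Set.mem_empty_iff_false, iff_false]
        rintro ⟨h1, h2⟩
        exact hne ⟨j, h1, h2⟩
      rw [this]; simp
  have hsum : (mmLaw μ).real (marks ⁻¹' D)
      = ∑ m ∈ Finset.range N, (mmLaw μ).real (marks ⁻¹' (D ∩ f ⁻¹' {m})) := by
    rw [← integral_indicator_one (measurable_marks hD)]
    -- With `φ = 1` the same splitting decomposes the probability of `D`.
    have h := indicator_randomIndex_eq (D := D) (φ := fun _ _ => 1) hN
    have h' : (marks ⁻¹' D).indicator (1 : (Sensor → ℕ → ℝ) → ℝ) = _ := h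
    rw [h', integral_finsetSum]
    · simp only [mul_one, hone]
    · intro m _
      simp only [mul_one]
      exact (integrable_const (1 : ℝ)).indicator (measurable_marks (hDm m))
  rw [indicator_randomIndex_eq hN, integral_finsetSum]
  · simp only [hterm]
    rw [hsum, Finset.mul_sum]
  · intro m _
    refine (hint m).bdd_mul (c := 1) ((hind m).comp measurable_marks).aestronglyMeasurable
      (Eventually.of_forall fun S => ?_)
    exact (norm_indicator_le_norm_self _ _).trans (by simp)

end

/-! ### The mean area per delivery and the almost sure limits -/

section

variable {μ : Sensor → ℝ} (hμ : ∀ i, 0 < μ i)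
include hμ

theorem measure_marks_ne : (mmLaw μ).real {S | marks S 1 ≠ marks S 0}
    = 2 * (μ Sensor.A * μ Sensor.B) / (μ Sensor.A + μ Sensor.B) ^ 2 := by
  have := isProbabilityMeasure_mmLaw hμ
  have hA := hμ Sensor.A
  have hB := hμ Sensor.B
  have hi : ∀ i k : Sensor, (mmLaw μ).real ({S | marks S 1 = i} ∩ {S | marks S 0 = k})
      = (μ i / (μ Sensor.A + μ Sensor.B)) * (μ k / (μ Sensor.A + μ Sensor.B)) := by
    intro i k
    have h := ((iIndepFun_marks hμ).indepFun (one_ne_zero)).measure_inter_preimage_eq_mul {i} {k}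
      trivial trivial
    rw [measureReal_def]
    refine (congrArg ENNReal.toReal h).trans ?_
    rw [ENNReal.toReal_mul]
    exact congrArg₂ _ (measure_marks hμ 1 i) (measure_marks hμ 0 k)
  have hset : {S : Sensor → ℕ → ℝ | marks S 1 ≠ marks S 0}
      = ({S | marks S 1 = Sensor.A} ∩ {S | marks S 0 = Sensor.B})
        ∪ ({S | marks S 1 = Sensor.B} ∩ {S | marks S 0 = Sensor.A}) := by
    ext S
    simp only [Set.mem_ofPred_eq, Set.mem_union, Set.mem_inter_iff]
    cases marks S 1 <;> cases marks S 0 <;> simp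
  have hm : ∀ n i, MeasurableSet {S : Sensor → ℕ → ℝ | marks S n = i} := fun n i =>
    measurable_marks_apply n (show MeasurableSet {i} from trivial)
  rw [hset, measureReal_union _ ((hm _ _).inter (hm _ _)), hi, hi]
  · field_simp
    ring
  · rw [Set.disjoint_left]
    rintro S ⟨h1, -⟩ ⟨h2, -⟩
    simp only [Set.mem_ofPred_eq] at h1 h2
    rw [h1] at h2; cases h2

/-- Area between two consecutive deliveries as a function of the last three of the deliveries. -/
noncomputable def blockArea (x : Fin 3 → ℝ × Sensor) : ℝ :=
  ((x 1).1 + if (x 1).2 ≠ (x 0).2 then (x 0).1 else 0) * (x 2).1 + (x 2).1 ^ 2 / 2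

omit hμ in
theorem measurable_blockArea : Measurable blockArea := by
  have h1 : ∀ a : Fin 3, Measurable fun x : Fin 3 → ℝ × Sensor => (x a).1 := fun a =>
    measurable_fst.comp (measurable_pi_apply a)
  have h2 : ∀ a : Fin 3, Measurable fun x : Fin 3 → ℝ × Sensor => (x a).2 := fun a =>
    measurable_snd.comp (measurable_pi_apply a)
  have h3 : Measurable fun x : Fin 3 → ℝ × Sensor =>
      if (x 1).2 ≠ (x 0).2 then (x 0).1 else 0 :=
    Measurable.ite (measurableSet_eq_fun (h2 1) (h2 0)).compl (h1 0) measurable_const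
  have h4 := (((h1 1).add h3).mul (h1 2)).add (((h1 2).pow_const 2).div_const 2)
  exact h4

/-- Products of distinct gaps and half the square of a gap all have mean `1 / s ^ 2`, where `s` is
the total rate. Two such terms are always present, and a third is present on a switch, an event
independent of the gaps. -/
theorem blockArea_integral : Integrable (fun S => blockArea fun a => (gaps S a, marks S a)) (mmLaw μ)
    ∧ ∫ S, blockArea (fun a => (gaps S a, marks S a)) ∂(mmLaw μ)
      = (2 + 2 * (μ Sensor.A * μ Sensor.B) / (μ Sensor.A + μ Sensor.B) ^ 2)
        / (μ Sensor.A + μ Sensor.B) ^ 2 := by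
  have hP := isProbabilityMeasure_mmLaw hμ
  have hA := hμ Sensor.A
  have hB := hμ Sensor.B
  have hD : MeasurableSet {j : ℕ → Sensor | j 1 ≠ j 0} :=
    (measurableSet_eq_fun (measurable_pi_apply 1) (measurable_pi_apply 0)).compl
  have hφ : Measurable fun e : ℕ → ℝ => e 0 * e 2 := by fun_prop
  have i1 := integrable_gaps_mul hμ 1 2
  have i2 := integrable_randomIndex hμ hD (f := fun _ => 0) measurable_const (N := 1) (by simp)
    (φ := fun _ e => e 0 * e 2) (fun _ => integrable_gaps_mul hμ 0 2)
  have i3 := (integrable_gaps_pow hμ 2 2).div_const 2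
  have v2 := integral_randomIndex hμ hD (f := fun _ => 0) measurable_const (N := 1) (by simp)
    (φ := fun _ e => e 0 * e 2) (fun _ => hφ) (fun _ => integrable_gaps_mul hμ 0 2)
    (fun _ _ => integral_gaps_mul hμ (by norm_num))
  have heq : (fun S => blockArea fun a => (gaps S a, marks S a)) = fun S =>
      gaps S 1 * gaps S 2 + (marks ⁻¹' {j : ℕ → Sensor | j 1 ≠ j 0}).indicator
        (fun S => gaps S 0 * gaps S 2) S + gaps S 2 ^ 2 / 2 := by
    funext S
    by_cases h : marks S 1 = marks S 0
    · simp [blockArea, h]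
    · simp [blockArea, h]; ring
  rw [heq]
  have i12 : Integrable (fun S => gaps S 1 * gaps S 2
      + (marks ⁻¹' {j : ℕ → Sensor | j 1 ≠ j 0}).indicator (fun S => gaps S 0 * gaps S 2) S)
      (mmLaw μ) := i1.add i2
  refine ⟨i12.add i3, ?_⟩
  rw [integral_add i12 i3, integral_add i1 i2, v2, integral_div, integral_gaps_pow hμ,
    integral_gaps_mul hμ (by norm_num)]
  have h6 : (mmLaw μ).real (marks ⁻¹' {j | j 1 ≠ j 0}) = _ := measure_marks_ne hμ
  rw [h6]
  simp only [Nat.factorial]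
  field_simp
  ring

omit hμ in
theorem sum_range_three_mul_add_two (w : ℕ → ℝ) (n : ℕ) : ∑ k ∈ Finset.range (3 * n + 2), w k
    = ∑ k ∈ Finset.range 2, w k
      + ∑ k ∈ Finset.range n, (w (3 * k + 2) + w (3 * k + 1 + 2) + w (3 * k + 2 + 2)) := by
  induction n with
  | zero => simp
  | succ n ih =>
    rw [show 3 * (n + 1) + 2 = (3 * n + 2) + 1 + 1 + 1 by ring, Finset.sum_range_succ w,
      Finset.sum_range_succ w, Finset.sum_range_succ w, ih, Finset.sum_range_succ _ n]
    ring

/-- From index 2 on, a summand is `blockArea` of three consecutive deliveries. Neighbouring summands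
are dependent, but those in one residue class modulo 3 use disjoint blocks, so the strong law is
applied to each class; the first two summands vanish after division by `n`. -/
theorem ae_tendsto_sum_area (a₀ : ℝ) : ∀ᵐ S ∂(mmLaw μ),
    Tendsto (fun n : ℕ => (∑ k ∈ Finset.range (3 * n + 2),
      (headAge a₀ (gaps S) (marks S) k * gaps S k + gaps S k ^ 2 / 2)) / (n : ℝ)) atTop
      (𝓝 (3 * ((2 + 2 * (μ Sensor.A * μ Sensor.B) / (μ Sensor.A + μ Sensor.B) ^ 2)
        / (μ Sensor.A + μ Sensor.B) ^ 2))) := by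
  have h := fun r => ae_tendsto_block hμ 3 r measurable_blockArea (blockArea_integral hμ).1
  rw [(blockArea_integral hμ).2] at h
  filter_upwards [h 0, h 1, h 2] with S h0 h1 h2
  have h3 := ((h0.add h1).add h2).add (((tendsto_const_nhds (x := ∑ k ∈ Finset.range 2,
    (headAge a₀ (gaps S) (marks S) k * gaps S k + gaps S k ^ 2 / 2))).mul
      (tendsto_one_div_atTop_nhds_zero_nat (𝕜 := ℝ))))
  rw [mul_zero, add_zero] at h3
  have hlim : ∀ c : ℝ, c + c + c = 3 * c := fun c => by ring
  rw [hlim] at h3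
  refine h3.congr fun n => ?_
  have hw : ∀ m, headAge a₀ (gaps S) (marks S) (m + 2) * gaps S (m + 2) + gaps S (m + 2) ^ 2 / 2
      = blockArea fun a : Fin 3 => (gaps S (a + m), marks S (a + m)) := by
    intro m
    have e1 : 1 + m = m + 1 := by ring
    have e2 : 2 + m = m + 2 := by ring
    simp only [headAge, Switch, blockArea, Nat.add_sub_cancel, Fin.val_zero, Fin.val_one,
      Fin.val_two, zero_add, e1, e2]
  rw [sum_range_three_mul_add_two]
  simp only [← hw, Finset.sum_add_distrib, add_zero]
  ring_nf

theorem ae_tendsto_timeAvgAoI {a₀ : ℝ} (ha : 0 ≤ a₀) : ∀ᵐ S ∂(mmLaw μ),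
    Tendsto (fun τ : ℝ => timeAvgAoI a₀ S τ) atTop
      (𝓝 (2 * (μ Sensor.A ^ 2 + 3 * μ Sensor.A * μ Sensor.B + μ Sensor.B ^ 2)
        / (μ Sensor.A + μ Sensor.B) ^ 3)) := by
  have hA := hμ Sensor.A
  have hB := hμ Sensor.B
  filter_upwards [ae_regular hμ, ae_tendsto_epoch hμ, ae_tendsto_sum_area hμ a₀] with S hS h1 h2
  convert hS.tendsto_timeAvgAoI ha (by positivity) h1 h2 using 2
  field_simp
  ring

theorem ae_tendsto_timeAvgArea {a₀ : ℝ} (ha : 0 ≤ a₀) : ∀ᵐ S ∂(mmLaw μ),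
    Tendsto (fun τ : ℝ => timeAvgArea a₀ S τ) atTop
      (𝓝 (2 * (μ Sensor.A ^ 2 + 3 * μ Sensor.A * μ Sensor.B + μ Sensor.B ^ 2)
        / (μ Sensor.A + μ Sensor.B) ^ 3)) := by
  have hA := hμ Sensor.A
  have hB := hμ Sensor.B
  filter_upwards [ae_regular hμ, ae_tendsto_epoch hμ, ae_tendsto_timeAvgAoI hμ ha] with S hS h1 h2
  exact hS.tendsto_timeAvgArea ha (by positivity) h1 h2

end

end DualQueue

/-! ### The Markov chain of successful receptions and its convergence -/

namespace DualQueue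

section Chain

/-- One step of the chain of successful receptions; a state records whether the last successful
update comes from another sensor than the preceding delivery, its sensor, and the sensors of the
deliveries to come. -/
def chainStep (q : (Bool × Sensor) × (ℕ → Sensor)) : (Bool × Sensor) × (ℕ → Sensor) :=
  if q.1.1 = true ∨ q.2 0 = q.1.2 then ((decide (q.2 0 ≠ q.1.2), q.2 0), fun n => q.2 (n + 1))
  else ((decide (q.2 1 ≠ q.2 0), q.2 1), fun n => q.2 (n + 2))

/-- State of the chain at the `m`-th delivery. -/
def chainState (j : ℕ → Sensor) (m : ℕ) : (Bool × Sensor) × (ℕ → Sensor) :=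
  ((decide (Switch j m), j (m - 1)), fun n => j (n + m))

theorem switch_add_two (j : ℕ → Sensor) (n : ℕ) : Switch j (n + 2) ↔ j (n + 1) ≠ j n := Iff.rfl

theorem skip_succ (j : ℕ → Sensor) (k : ℕ) :
    Skip j (k + 1) ↔ ¬ Switch j (k + 1) ∧ j (k + 1) ≠ j k := Iff.rfl

/-- Carrying the future marks in the state makes the jump to the next reception a deterministic map,
which can be iterated without stopping times. -/
theorem chainStep_chainState (j : ℕ → Sensor) {m : ℕ} (hm : 1 ≤ m) :
    chainStep (chainState j m) = chainState j (m + 1 + if Skip j m then 1 else 0) := by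
  obtain ⟨k, rfl⟩ : ∃ k, m = k + 1 := ⟨m - 1, by omega⟩
  have h1 : ∀ n, n + 1 + (k + 1) = n + (k + 1 + 1) := fun n => by ring
  have h2 : ∀ n, n + 1 + (k + 1 + 1) = n + (k + 1 + 1 + 1) := fun n => by ring
  have h4 : Switch j (k + 1 + 1) ↔ j (k + 1) ≠ j k := switch_add_two j k
  have h5 : Switch j (k + 1 + 1 + 1) ↔ j (k + 1 + 1) ≠ j (k + 1) := switch_add_two j (k + 1)
  by_cases hs : Switch j (k + 1) <;> by_cases hj : j (k + 1) = j k <;>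
    simp [chainStep, chainState, skip_succ, h4, h5, hs, hj, h1, h2]

theorem chainStep_iterate (j : ℕ → Sensor) (n : ℕ) :
    chainStep^[n] (chainState j 1) = chainState j (acceptedIndex j n) := by
  induction n with
  | zero => rfl
  | succ n ih =>
    have := one_le_acceptedIndex j n
    rw [Function.iterate_succ_apply', ih, chainStep_chainState j (by omega), acceptedIndex]

theorem measurable_chainStep : Measurable chainStep := by
  have he : ∀ n, Measurable fun q : (Bool × Sensor) × (ℕ → Sensor) => q.2 n := fun n =>
    (measurable_pi_apply n).comp measurable_snd
  refine Measurable.ite ?_ (Measurable.prodMk ?_ ?_) (Measurable.prodMk ?_ ?_)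
  · exact (measurable_fst.prodMk (he 0)) (t := {x : (Bool × Sensor) × Sensor |
      x.1.1 = true ∨ x.2 = x.1.2}) (MeasurableSet.of_discrete)
  · exact (Measurable.of_discrete (f := fun x : Sensor × Sensor => (decide (x.1 ≠ x.2), x.1))).comp
      ((he 0).prodMk (measurable_snd.comp measurable_fst))
  · exact measurable_pi_iff.2 fun n => he (n + 1)
  · exact (Measurable.of_discrete (f := fun x : Sensor × Sensor => (decide (x.1 ≠ x.2), x.1))).comp
      ((he 1).prodMk (he 0))
  · exact measurable_pi_iff.2 fun n => he (n + 2)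

/-- The other sensor. -/
def other : Sensor → Sensor
  | Sensor.A => Sensor.B
  | Sensor.B => Sensor.A

/-- Transition operator of the chain of successful receptions. -/
def chainOp (p : Sensor → ℝ) (u : Bool × Sensor → ℝ) : Bool × Sensor → ℝ
  | (true, i) => p i * u (false, i) + p (other i) * u (true, other i)
  | (false, i) => p i * u (false, i)
      + p (other i) * (p i * u (true, i) + p (other i) * u (false, other i))

/-- Mean with respect to the stationary distribution of the chain. -/
noncomputable def chainMean (p : Sensor → ℝ) (u : Bool × Sensor → ℝ) : ℝ :=
  (p Sensor.A ^ 2 * u (false, Sensor.A) + p Sensor.B ^ 2 * u (false, Sensor.B)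
    + p Sensor.A ^ 2 * p Sensor.B * u (true, Sensor.A)
    + p Sensor.B ^ 2 * p Sensor.A * u (true, Sensor.B)) / (1 - p Sensor.A * p Sensor.B)

variable {p : Sensor → ℝ} (hp : ∀ i, 0 < p i) (hsum : p Sensor.A + p Sensor.B = 1)
include hp hsum

theorem one_sub_mul_pos : 0 < 1 - p Sensor.A * p Sensor.B := by
  have hA := hp Sensor.A
  have hB := hp Sensor.B
  nlinarith

omit hp in
-- The balance equations for the stationary weights: after `p B = 1 - p A` the numerators agree as
-- polynomials, and the denominator plays no role.
theorem chainMean_chainOp (u : Bool × Sensor → ℝ) :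
    chainMean p (chainOp p u) = chainMean p u := by
  simp only [chainMean, chainOp, other]
  congr 1
  obtain hB : p Sensor.B = 1 - p Sensor.A := by linarith
  rw [hB]
  ring

theorem chainMean_mem {u : Bool × Sensor → ℝ} {L U : ℝ} (hL : ∀ x, L ≤ u x) (hU : ∀ x, u x ≤ U) :
    L ≤ chainMean p u ∧ chainMean p u ≤ U := by
  have hA := hp Sensor.A
  have hB := hp Sensor.B
  have h1 := one_sub_mul_pos hp hsum
  have hw : p Sensor.A ^ 2 + p Sensor.B ^ 2 + p Sensor.A ^ 2 * p Sensor.B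
      + p Sensor.B ^ 2 * p Sensor.A = 1 - p Sensor.A * p Sensor.B := by
    obtain hB : p Sensor.B = 1 - p Sensor.A := by linarith
    rw [hB]; ring
  have w1 : 0 ≤ p Sensor.A ^ 2 := by positivity
  have w2 : 0 ≤ p Sensor.B ^ 2 := by positivity
  have w3 : 0 ≤ p Sensor.A ^ 2 * p Sensor.B := by positivity
  have w4 : 0 ≤ p Sensor.B ^ 2 * p Sensor.A := by positivity
  constructor
  · rw [chainMean, le_div_iff₀ h1, ← hw]
    have := mul_le_mul_of_nonneg_left (hL (false, Sensor.A)) w1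
    have := mul_le_mul_of_nonneg_left (hL (false, Sensor.B)) w2
    have := mul_le_mul_of_nonneg_left (hL (true, Sensor.A)) w3
    have := mul_le_mul_of_nonneg_left (hL (true, Sensor.B)) w4
    linarith
  · rw [chainMean, div_le_iff₀ h1, ← hw]
    have := mul_le_mul_of_nonneg_left (hU (false, Sensor.A)) w1
    have := mul_le_mul_of_nonneg_left (hU (false, Sensor.B)) w2
    have := mul_le_mul_of_nonneg_left (hU (true, Sensor.A)) w3
    have := mul_le_mul_of_nonneg_left (hU (true, Sensor.B)) w4
    linarith

omit hp in
theorem sum_other (i : Sensor) : p i + p (other i) = 1 := by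
  cases i
  · exact hsum
  · rw [add_comm]; exact hsum

theorem le_chainOp {u : Bool × Sensor → ℝ} {L : ℝ} (hL : ∀ x, L ≤ u x) (x : Bool × Sensor) :
    L ≤ chainOp p u x := by
  obtain ⟨b, i⟩ := x
  have hi := (hp i).le
  have ho := (hp (other i)).le
  have hs := sum_other hsum i
  have h1 := mul_le_mul_of_nonneg_left (hL (false, i)) hi
  cases b
  · have h2 := mul_le_mul_of_nonneg_left (hL (true, i)) hi
    have h3 := mul_le_mul_of_nonneg_left (hL (false, other i)) ho
    have h4 : L ≤ p i * u (true, i) + p (other i) * u (false, other i) := by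
      calc L = p i * L + p (other i) * L := by rw [← add_mul, hs, one_mul]
        _ ≤ _ := by linarith
    have h5 := mul_le_mul_of_nonneg_left h4 ho
    calc L = p i * L + p (other i) * L := by rw [← add_mul, hs, one_mul]
      _ ≤ _ := by rw [chainOp]; linarith
  · have h3 := mul_le_mul_of_nonneg_left (hL (true, other i)) ho
    calc L = p i * L + p (other i) * L := by rw [← add_mul, hs, one_mul]
      _ ≤ _ := by rw [chainOp]; linarith

omit hp hsum in
theorem chainOp_neg (u : Bool × Sensor → ℝ) : chainOp p (-u) = -chainOp p u := by
  funext ⟨b, i⟩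
  cases b <;> simp only [chainOp, Pi.neg_apply] <;> ring

theorem chainOp_le {u : Bool × Sensor → ℝ} {U : ℝ} (hU : ∀ x, u x ≤ U) (x : Bool × Sensor) :
    chainOp p u x ≤ U := by
  have h := le_chainOp hp hsum (u := -u) (L := -U) (fun x => neg_le_neg (hU x)) x
  rw [chainOp_neg] at h
  exact neg_le_neg_iff.1 h

/-- After two steps every state has reached `(false, A)` with a probability bounded below. -/
theorem le_chainOp_chainOp {u : Bool × Sensor → ℝ} {L : ℝ} (hL : ∀ x, L ≤ u x)
    (x : Bool × Sensor) :
    L + p Sensor.A ^ 3 * (u (false, Sensor.A) - L) ≤ chainOp p (chainOp p u) x := by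
  set a := p Sensor.A with ha
  set b := p Sensor.B with hb
  have hA : 0 < a := hp Sensor.A
  have hB : 0 < b := hp Sensor.B
  have ha1 : a ≤ 1 := by linarith
  have hb1 : b = 1 - a := by linarith
  set d := u (false, Sensor.A) - L with hd
  have hd0 : 0 ≤ d := sub_nonneg.2 (hL _)
  have k2 : a ^ 2 * d ≤ a * d := mul_le_mul_of_nonneg_right (by nlinarith) hd0
  have k3 : a ^ 3 * d ≤ a ^ 2 * d := mul_le_mul_of_nonneg_right (by nlinarith [sq_nonneg a]) hd0
  have ed : u (false, Sensor.A) = L + d := by rw [hd]; ring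
  -- a lower bound for a convex combination
  have mix : ∀ {x y r s : ℝ}, L + r ≤ x → L + s ≤ y → L + (a * r + b * s) ≤ a * x + b * y := by
    intro x y r s h1 h2
    have h3 := mul_le_mul_of_nonneg_left h1 hA.le
    have h4 := mul_le_mul_of_nonneg_left h2 hB.le
    have : L + (a * r + b * s) = a * (L + r) + b * (L + s) := by rw [hb1]; ring
    linarith
  have z : ∀ {v : Bool × Sensor → ℝ}, (∀ x, L ≤ v x) → ∀ x, L + 0 ≤ v x := fun h x => by
    rw [add_zero]; exact h x
  have hv := le_chainOp hp hsum hL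
  have hu := z hL
  have v1 : L + a * d ≤ chainOp p u (false, Sensor.A) := by
    have := mix ed.ge (mix (hu (true, Sensor.A)) (hu (false, Sensor.B)))
    simp only [chainOp, other, ← ha, ← hb]
    linarith
  -- Two-step paths to `(false, A)` that stay at it or pass through it have probability `a ^ 2` from
  -- `(false, A)` and `(true, A)`. From `(true, B)`, the path through `(true, A)` also has `a ^ 2`.
  -- From `(false, B)`, the first step alone needs two marks `A`, so the path has `a ^ 3`, the
  -- smallest of the four.
  have w1 : ∀ x, L + a ^ 3 * d ≤ chainOp p (chainOp p u) x := by
    rintro ⟨_ | _, _ | _⟩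
    · have := mix v1 (mix (z hv (true, Sensor.A)) (z hv (false, Sensor.B)))
      rw [chainOp]
      simp only [other, ← ha, ← hb]
      linarith
    · have := mix (mix v1 (z hv (true, Sensor.B))) (z hv (false, Sensor.B))
      rw [chainOp]
      simp only [other, ← ha, ← hb]
      linarith
    · have := mix v1 (z hv (true, Sensor.B))
      rw [chainOp]
      simp only [other, ← ha, ← hb]
      linarith
    · have v2 : L + a * d ≤ chainOp p u (true, Sensor.A) := by
        have := mix ed.ge (hu (true, Sensor.B))
        simp only [chainOp, other, ← ha, ← hb]
        linarith
      have := mix v2 (z hv (false, Sensor.B))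
      rw [chainOp]
      simp only [other, ← ha, ← hb]
      linarith
  exact w1 x

theorem chainOp_chainOp_le {u : Bool × Sensor → ℝ} {U : ℝ} (hU : ∀ x, u x ≤ U)
    (x : Bool × Sensor) :
    chainOp p (chainOp p u) x ≤ U - p Sensor.A ^ 3 * (U - u (false, Sensor.A)) := by
  have h := le_chainOp_chainOp hp hsum (u := -u) (L := -U) (fun x => neg_le_neg (hU x)) x
  rw [chainOp_neg, chainOp_neg] at h
  simp only [Pi.neg_apply] at h
  linarith

/-- Doeblin's contraction: two steps move both bounds towards the common value at `(false, A)`, each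
by the fraction `p A ^ 3` of its distance, so their difference shrinks by `1 - p A ^ 3`. -/
theorem exists_bounds_chainOp_iterate (u : Bool × Sensor → ℝ) : ∃ C : ℝ, ∀ n, ∃ L U : ℝ,
    U - L = (1 - p Sensor.A ^ 3) ^ n * C ∧ ∀ x, L ≤ (chainOp p)^[2 * n] u x
      ∧ (chainOp p)^[2 * n] u x ≤ U := by
  obtain ⟨L₀, hL₀⟩ := (Set.finite_range u).bddBelow
  obtain ⟨U₀, hU₀⟩ := (Set.finite_range u).bddAbove
  refine ⟨U₀ - L₀, fun n => ?_⟩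
  induction n with
  | zero => exact ⟨L₀, U₀, by simp, fun x => ⟨hL₀ ⟨x, rfl⟩, hU₀ ⟨x, rfl⟩⟩⟩
  | succ n ih =>
    obtain ⟨L, U, hLU, h⟩ := ih
    set v := (chainOp p)^[2 * n] u with hv
    refine ⟨L + p Sensor.A ^ 3 * (v (false, Sensor.A) - L),
      U - p Sensor.A ^ 3 * (U - v (false, Sensor.A)), ?_, fun x => ?_⟩
    · rw [pow_succ]
      linear_combination (1 - p Sensor.A ^ 3) * hLU
    · rw [show 2 * (n + 1) = 2 * n + 1 + 1 by ring, Function.iterate_succ_apply',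
        Function.iterate_succ_apply', ← hv]
      exact ⟨le_chainOp_chainOp hp hsum (fun x => (h x).1) x,
        chainOp_chainOp_le hp hsum (fun x => (h x).2) x⟩

/-- The stationary mean is invariant and lies between the same bounds as the iterate, so their
distance is at most the shrinking range. An odd extra step respects the bounds. -/
theorem tendsto_chainOp_iterate (u : Bool × Sensor → ℝ) (x : Bool × Sensor) :
    Tendsto (fun n => (chainOp p)^[n] u x) atTop (𝓝 (chainMean p u)) := by
  obtain ⟨C, hC⟩ := exists_bounds_chainOp_iterate hp hsum u
  have hA := hp Sensor.A
  have hA1 : p Sensor.A < 1 := by linarith [hp Sensor.B]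
  have hρ0 : 0 ≤ 1 - p Sensor.A ^ 3 := by linarith [pow_le_one₀ (n := 3) hA.le hA1.le]
  have hρ1 : 1 - p Sensor.A ^ 3 < 1 := by linarith [pow_pos hA 3]
  have hmean : ∀ n, chainMean p ((chainOp p)^[n] u) = chainMean p u := by
    intro n
    induction n with
    | zero => rfl
    | succ n ih => rw [Function.iterate_succ_apply', chainMean_chainOp hsum, ih]
  have hbound : ∀ n, |(chainOp p)^[n] u x - chainMean p u| ≤ (1 - p Sensor.A ^ 3) ^ (n / 2) * C := by
    intro n
    obtain ⟨L, U, hLU, h⟩ := hC (n / 2)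
    have hn : ∀ x, L ≤ (chainOp p)^[n] u x ∧ (chainOp p)^[n] u x ≤ U := by
      rcases Nat.even_or_odd' n with ⟨k, rfl | rfl⟩
      · rw [Nat.mul_div_cancel_left k two_pos] at h
        exact h
      · rw [show (2 * k + 1) / 2 = k by omega] at h
        intro x
        rw [Function.iterate_succ_apply']
        exact ⟨le_chainOp hp hsum (fun x => (h x).1) x, chainOp_le hp hsum (fun x => (h x).2) x⟩
    have hm := chainMean_mem hp hsum (fun x => (hn x).1) (fun x => (hn x).2)
    rw [hmean] at hm
    rw [← hLU, abs_le]
    constructor <;> linarith [(hn x).1, (hn x).2, hm.1, hm.2]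
  have hlim : Tendsto (fun n : ℕ => (1 - p Sensor.A ^ 3) ^ (n / 2) * C) atTop (𝓝 0) := by
    have h1 := (tendsto_pow_atTop_nhds_zero_of_lt_one hρ0 hρ1).comp
      (Nat.tendsto_div_const_atTop two_ne_zero)
    simpa using h1.mul_const C
  rw [tendsto_iff_dist_tendsto_zero]
  exact squeeze_zero (fun n => dist_nonneg) hbound hlim

end Chain

/-! ### Means along the chain and the limiting probabilities -/

section

variable {μ : Sensor → ℝ} (hμ : ∀ i, 0 < μ i)

/-- Probabilities of the sensors at a delivery. -/
noncomputable def markProb (μ : Sensor → ℝ) (i : Sensor) : ℝ := μ i / (μ Sensor.A + μ Sensor.B)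

include hμ

theorem markProb_pos (i : Sensor) : 0 < markProb μ i :=
  div_pos (hμ i) (add_pos (hμ _) (hμ _))

theorem markProb_sum : markProb μ Sensor.A + markProb μ Sensor.B = 1 := by
  rw [markProb, markProb, ← add_div, div_self (add_pos (hμ _) (hμ _)).ne']

theorem integral_markLaw (g : Sensor → ℝ) :
    ∫ i, g i ∂(markLaw μ) = markProb μ Sensor.A * g Sensor.A + markProb μ Sensor.B * g Sensor.B := by
  have hg : ∀ i, Integrable g (Measure.dirac i) := fun i => integrable_dirac (by simp)
  rw [markLaw, integral_add_measure ((hg _).smul_measure ENNReal.ofReal_ne_top)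
    ((hg _).smul_measure ENNReal.ofReal_ne_top), integral_smul_measure, integral_smul_measure,
    integral_dirac, integral_dirac,
    ENNReal.toReal_ofReal (by exact (markProb_pos hμ _).le),
    ENNReal.toReal_ofReal (by exact (markProb_pos hμ _).le)]
  rfl

/-- Conditioning on the sensor of the first delivery. -/
theorem integral_marks_head (K : Sensor → (ℕ → Sensor) → ℝ) (hK : ∀ i, Measurable (K i)) {C : ℝ}
    (hC : ∀ i j, |K i j| ≤ C) :
    ∫ S, K (marks S 0) (fun n => marks S (n + 1)) ∂(mmLaw μ)
      = markProb μ Sensor.A * ∫ S, K Sensor.A (marks S) ∂(mmLaw μ)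
        + markProb μ Sensor.B * ∫ S, K Sensor.B (marks S) ∂(mmLaw μ) := by
  have := isProbabilityMeasure_mmLaw hμ
  have := isProbabilityMeasure_markLaw hμ
  have := isProbabilityMeasure_expMeasure (add_pos (hμ Sensor.A) (hμ Sensor.B))
  have hK2 : Measurable fun q : Sensor × (ℕ → Sensor) => K q.1 q.2 :=
    measurable_from_prod_countable_right hK
  have hKm : Measurable fun q : (ℝ × Sensor) × (Sensor → ℕ → ℝ) => K q.1.2 (marks q.2) :=
    hK2.comp ((measurable_snd.comp measurable_fst).prodMk (measurable_marks.comp measurable_snd))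
  have hΦ : Measurable fun S => ((gap S, nextSensor S), residual S) :=
    (measurable_gap.prodMk measurable_nextSensor).prodMk measurable_residual
  have h1 : ∫ S, K (marks S 0) (fun n => marks S (n + 1)) ∂(mmLaw μ)
      = ∫ q, K q.1.2 (marks q.2) ∂(((expMeasure (μ Sensor.A + μ Sensor.B)).prod (markLaw μ)).prod
        (mmLaw μ)) := by
    rw [mmLaw, ← map_gap_residual hμ, integral_map hΦ.aemeasurable hKm.aestronglyMeasurable]
    rfl
  rw [h1, integral_prod _ (Integrable.of_bound hKm.aestronglyMeasurable C
    (Eventually.of_forall fun q => hC _ _))]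
  have h2 := integral_fun_snd (μ := expMeasure (μ Sensor.A + μ Sensor.B)) (ν := markLaw μ)
    (fun i => ∫ S, K i (marks S) ∂(mmLaw μ))
  refine h2.trans ?_
  rw [probReal_univ, one_smul, integral_markLaw hμ]

/-- Mean of an observable of the chain started at a given state. -/
theorem integral_chainStep {h : (Bool × Sensor) × (ℕ → Sensor) → ℝ} (hh : Measurable h) {C : ℝ}
    (hC : ∀ q, |h q| ≤ C) (x : Bool × Sensor) :
    ∫ S, h (chainStep (x, marks S)) ∂(mmLaw μ)
      = chainOp (markProb μ) (fun y => ∫ S, h (y, marks S) ∂(mmLaw μ)) x := by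
  have hm : ∀ y, Measurable fun j => h (y, j) := fun y => hh.comp measurable_prodMk_left
  -- the law after one more delivery
  have key : ∀ i, ∫ S, h ((decide (marks S 0 ≠ i), marks S 0), fun n => marks S (n + 1)) ∂(mmLaw μ)
      = markProb μ i * ∫ S, h ((false, i), marks S) ∂(mmLaw μ)
        + markProb μ (other i) * ∫ S, h ((true, other i), marks S) ∂(mmLaw μ) := by
    intro i
    rw [integral_marks_head hμ (fun y j => h ((decide (y ≠ i), y), j)) (fun y => hm _)
      fun _ _ => hC _]
    cases i <;> simp [other, add_comm]
  obtain ⟨b, i⟩ := x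
  cases b
  -- From `(false, i)` a delivery by the other sensor is obsolete and the following one is received.
  -- `K` describes what happens once the first mark `y` is known; in the obsolete case `key` then
  -- conditions on the second mark.
  · let K : Sensor → (ℕ → Sensor) → ℝ := fun y j =>
      if y = i then h ((false, i), j)
      else h ((decide (j 0 ≠ y), j 0), fun n => j (n + 1))
    have hmt : ∀ y, Measurable fun j : ℕ → Sensor =>
        h ((decide (j 0 ≠ y), j 0), fun n => j (n + 1)) := by
      intro y
      refine hh.comp (Measurable.prodMk ?_ (measurable_pi_iff.2 fun n => measurable_pi_apply (n + 1)))
      exact (Measurable.of_discrete (f := fun z : Sensor => (decide (z ≠ y), z))).comp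
        (measurable_pi_apply 0)
    have hK : ∀ y, Measurable (K y) := by
      intro y
      by_cases hy : y = i
      · simpa [K, hy] using hm _
      · simpa [K, hy] using hmt y
    have hKC : ∀ y j, |K y j| ≤ C := by
      intro y j
      simp only [K]
      split_ifs <;> exact hC _
    have h1 : ∀ S, h (chainStep ((false, i), marks S))
        = K (marks S 0) (fun n => marks S (n + 1)) := by
      intro S
      by_cases hy : marks S 0 = i
      · simp [chainStep, K, hy]
      · simp [chainStep, K, hy]
    simp only [h1]
    rw [integral_marks_head hμ K hK hKC]
    cases i
    · have e1 : ∀ j, K Sensor.A j = h ((false, Sensor.A), j) := fun j => by simp [K]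
      have e2 : ∀ j, K Sensor.B j = h ((decide (j 0 ≠ Sensor.B), j 0), fun n => j (n + 1)) :=
        fun j => by simp [K]
      simp only [e1, e2]
      rw [key, chainOp, other]
      simp only [other]
      ring
    · have e1 : ∀ j, K Sensor.B j = h ((false, Sensor.B), j) := fun j => by simp [K]
      have e2 : ∀ j, K Sensor.A j = h ((decide (j 0 ≠ Sensor.A), j 0), fun n => j (n + 1)) :=
        fun j => by simp [K]
      simp only [e1, e2]
      rw [key, chainOp, other]
      simp only [other]
      ring
  · simp only [chainStep, true_or, if_true]
    rw [key, chainOp]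

theorem integral_chainStep_iterate {h : (Bool × Sensor) × (ℕ → Sensor) → ℝ} (hh : Measurable h)
    {C : ℝ} (hC : ∀ q, |h q| ≤ C) (n : ℕ) (x : Bool × Sensor) :
    ∫ S, h (chainStep^[n] (x, marks S)) ∂(mmLaw μ)
      = (chainOp (markProb μ))^[n] (fun y => ∫ S, h (y, marks S) ∂(mmLaw μ)) x := by
  induction n generalizing x with
  | zero => rfl
  | succ n ih =>
    have h1 := integral_chainStep hμ (h := fun q => h (chainStep^[n] q))
      (hh.comp (measurable_chainStep.iterate n)) (fun q => hC _) x
    simp only [Function.iterate_succ_apply]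
    rw [h1, ← Function.iterate_succ_apply, Function.iterate_succ_apply']
    congr 1
    funext y
    exact ih y

/-- Convergence of the mean of an observable of the chain of successful receptions. -/
theorem tendsto_integral_chainState {h : (Bool × Sensor) × (ℕ → Sensor) → ℝ} (hh : Measurable h)
    {C : ℝ} (hC : ∀ q, |h q| ≤ C) :
    Tendsto (fun n => ∫ S, h (chainState (marks S) (acceptedIndex (marks S) n)) ∂(mmLaw μ)) atTop
      (𝓝 (chainMean (markProb μ) fun y => ∫ S, h (y, marks S) ∂(mmLaw μ))) := by
  -- The first delivery is never a switch, so the chain starts in `(false, i)` with `i` the first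
  -- mark.
  have h1 : ∀ n, ∫ S, h (chainState (marks S) (acceptedIndex (marks S) n)) ∂(mmLaw μ)
      = markProb μ Sensor.A * (chainOp (markProb μ))^[n]
          (fun y => ∫ S, h (y, marks S) ∂(mmLaw μ)) (false, Sensor.A)
        + markProb μ Sensor.B * (chainOp (markProb μ))^[n]
          (fun y => ∫ S, h (y, marks S) ∂(mmLaw μ)) (false, Sensor.B) := by
    intro n
    rw [← integral_chainStep_iterate hμ hh hC, ← integral_chainStep_iterate hμ hh hC,
      ← integral_marks_head hμ (fun y j => h (chainStep^[n] ((false, y), j)))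
        (fun y => (hh.comp (measurable_chainStep.iterate n)).comp measurable_prodMk_left)
        (fun _ _ => hC _)]
    refine integral_congr_ae (Eventually.of_forall fun S => ?_)
    simp only [← chainStep_iterate]
    rfl
  simp only [h1]
  have h2 := fun x => tendsto_chainOp_iterate (markProb_pos hμ) (markProb_sum hμ)
    (fun y => ∫ S, h (y, marks S) ∂(mmLaw μ)) x
  have h3 := ((h2 (false, Sensor.A)).const_mul (markProb μ Sensor.A)).add
    ((h2 (false, Sensor.B)).const_mul (markProb μ Sensor.B))
  rwa [← add_mul, markProb_sum hμ, one_mul] at h3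

/-- The stationary mass of the states `(true, i)` has numerator `p A ^ 2 * p B + p B ^ 2 * p A`,
which is `p A * p B` since the probabilities sum to 1. -/
theorem tendsto_measure_switch :
    Tendsto (fun n => (mmLaw μ).real {S | Switch (marks S) (acceptedIndex (marks S) n)}) atTop
      (𝓝 (markProb μ Sensor.A * markProb μ Sensor.B
        / (1 - markProb μ Sensor.A * markProb μ Sensor.B))) := by
  have hP := isProbabilityMeasure_mmLaw hμ
  have hsum := markProb_sum hμ
  let h : (Bool × Sensor) × (ℕ → Sensor) → ℝ := fun q => if q.1.1 = true then 1 else 0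
  have hh : Measurable h := (Measurable.of_discrete
    (f := fun x : Bool × Sensor => if x.1 = true then (1 : ℝ) else 0)).comp measurable_fst
  have hC : ∀ q, |h q| ≤ 1 := by intro q; simp only [h]; split_ifs <;> simp
  have h1 := tendsto_integral_chainState hμ hh hC
  have h2 : chainMean (markProb μ) (fun y => ∫ S, h (y, marks S) ∂(mmLaw μ))
      = markProb μ Sensor.A * markProb μ Sensor.B
        / (1 - markProb μ Sensor.A * markProb μ Sensor.B) := by
    simp only [chainMean, h]
    congr 1
    simp only [Bool.false_eq_true, if_false, if_true, integral_const, probReal_univ, smul_eq_mul]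
    linear_combination (markProb μ Sensor.A * markProb μ Sensor.B) * hsum
  rw [h2] at h1
  refine h1.congr fun n => ?_
  have hms : MeasurableSet {S | Switch (marks S) (acceptedIndex (marks S) n)} :=
    measurable_marks (measurableSet_randomIndex measurableSet_switch (measurable_acceptedIndex n))
  rw [← integral_indicator_one hms]
  refine integral_congr_ae (Eventually.of_forall fun S => ?_)
  simp [h, chainState, Set.indicator_apply]

/-- A skip needs a state `(false, i)` and a next mark different from `i`; the stationary weights `p
i ^ 2` give the same numerator as for a switch. -/
theorem tendsto_measure_skip :
    Tendsto (fun n => (mmLaw μ).real {S | Skip (marks S) (acceptedIndex (marks S) n)}) atTop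
      (𝓝 (markProb μ Sensor.A * markProb μ Sensor.B
        / (1 - markProb μ Sensor.A * markProb μ Sensor.B))) := by
  have hP := isProbabilityMeasure_mmLaw hμ
  have hsum := markProb_sum hμ
  let h : (Bool × Sensor) × (ℕ → Sensor) → ℝ := fun q =>
    if q.1.1 = false ∧ q.2 0 ≠ q.1.2 then 1 else 0
  have hh : Measurable h := (Measurable.of_discrete (f := fun x : (Bool × Sensor) × Sensor =>
    if x.1.1 = false ∧ x.2 ≠ x.1.2 then (1 : ℝ) else 0)).comp
      (measurable_fst.prodMk ((measurable_pi_apply 0).comp measurable_snd))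
  have hC : ∀ q, |h q| ≤ 1 := by intro q; simp only [h]; split_ifs <;> simp
  have h1 := tendsto_integral_chainState hμ hh hC
  have hne : ∀ i, ∫ S, h ((false, i), marks S) ∂(mmLaw μ) = markProb μ (other i) := by
    intro i
    rw [markProb, ← measure_marks hμ 0, ← integral_indicator_one]
    · refine integral_congr_ae (Eventually.of_forall fun S => ?_)
      have hi : marks S 0 ≠ i ↔ marks S 0 = other i := by
        generalize marks S 0 = y
        cases i <;> cases y <;> simp [other]
      simp [h, Set.indicator_apply, hi]
    · exact measurable_marks_apply 0 (show MeasurableSet {other i} from trivial)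
  have hne' : ∀ i, ∫ S, h ((true, i), marks S) ∂(mmLaw μ) = 0 := by
    intro i; simp [h]
  have h2 : chainMean (markProb μ) (fun y => ∫ S, h (y, marks S) ∂(mmLaw μ))
      = markProb μ Sensor.A * markProb μ Sensor.B
        / (1 - markProb μ Sensor.A * markProb μ Sensor.B) := by
    simp only [chainMean, hne, hne', other]
    congr 1
    linear_combination (markProb μ Sensor.A * markProb μ Sensor.B) * hsum
  rw [h2] at h1
  refine h1.congr fun n => ?_
  have hms : MeasurableSet {S | Skip (marks S) (acceptedIndex (marks S) n)} :=
    measurable_marks (measurableSet_randomIndex measurableSet_skip (measurable_acceptedIndex n))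
  rw [← integral_indicator_one hms]
  refine integral_congr_ae (Eventually.of_forall fun S => ?_)
  obtain ⟨m, hm⟩ : ∃ m, acceptedIndex (marks S) n = m + 1 :=
    ⟨_, (Nat.sub_add_cancel ((Nat.le_add_left 1 n).trans (one_le_acceptedIndex _ n))).symm⟩
  simp [h, chainState, Set.indicator_apply, skip_succ, hm]

end

end DualQueue

/-! ### Means of areas and inter-arrival times -/

namespace DualQueue

/-- Time between the `k`-th and the `k+1`-st term of `acceptedIndex`. -/
noncomputable def cycleLength (k : ℕ) (S : Sensor → ℕ → ℝ) : ℝ :=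
  gaps S (acceptedIndex (marks S) k)
    + (marks ⁻¹' {j | Skip j (acceptedIndex j k)}).indicator
      (fun S => gaps S (acceptedIndex (marks S) k + 1)) S

/-- Area under the age curve between the `k`-th and the `k+1`-st term of `acceptedIndex`. -/
noncomputable def cycleArea (k : ℕ) (S : Sensor → ℕ → ℝ) : ℝ :=
  gaps S (acceptedIndex (marks S) k - 1) * gaps S (acceptedIndex (marks S) k)
    + gaps S (acceptedIndex (marks S) k) ^ 2 / 2
    + (marks ⁻¹' {j | Skip j (acceptedIndex j k)}).indicator (fun S =>
        gaps S (acceptedIndex (marks S) k - 1) * gaps S (acceptedIndex (marks S) k + 1)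
        + gaps S (acceptedIndex (marks S) k) * gaps S (acceptedIndex (marks S) k + 1)
        + gaps S (acceptedIndex (marks S) k + 1) ^ 2 / 2) S
    + (marks ⁻¹' {j | Switch j (acceptedIndex j k)}).indicator (fun S =>
        gaps S (acceptedIndex (marks S) k - 1 - 1) * gaps S (acceptedIndex (marks S) k)) S

/-- The shift records whether the first delivery, generated at time 0, is strictly fresher than
`-a₀`; it does not depend on the marks and disappears in the limit. -/
theorem exists_refreshIndex_succ_eq (a₀ : ℝ) : ∃ δ, ∀ (j : ℕ → Sensor) (n : ℕ),
    refreshIndex a₀ j (n + 1) = acceptedIndex j (n + δ) := by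
  by_cases h : 0 < a₀
  · exact ⟨0, fun j n => by rw [refreshIndex, if_pos h, add_zero]⟩
  · exact ⟨1, fun j n => by rw [refreshIndex, if_neg h]⟩

theorem epoch_acceptedIndex_succ (S : Sensor → ℕ → ℝ) (k : ℕ) :
    epoch (gaps S) (acceptedIndex (marks S) (k + 1)) - epoch (gaps S) (acceptedIndex (marks S) k)
      = cycleLength k S := by
  by_cases h : Skip (marks S) (acceptedIndex (marks S) k)
  · have hS : S ∈ marks ⁻¹' {j | Skip j (acceptedIndex j k)} := h
    rw [cycleLength, Set.indicator_of_mem hS, acceptedIndex, if_pos h, epoch_succ, epoch_succ]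
    ring
  · have hS : S ∉ marks ⁻¹' {j | Skip j (acceptedIndex j k)} := h
    rw [cycleLength, Set.indicator_of_notMem hS, acceptedIndex, if_neg h, add_zero, epoch_succ]
    ring

/-- Expansion into products of two gaps and half squares, whose means are known. A skip excludes a
switch at the same index, so the older gap in the age never meets the extra gap of the cycle. -/
theorem headAge_mul_cycleLength (a₀ : ℝ) (S : Sensor → ℕ → ℝ) (k : ℕ) :
    headAge a₀ (gaps S) (marks S) (acceptedIndex (marks S) k) * cycleLength k S
      + cycleLength k S ^ 2 / 2 = cycleArea k S := by
  obtain ⟨m, hm⟩ : ∃ l, acceptedIndex (marks S) k = l + 1 :=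
    ⟨_, (Nat.sub_add_cancel ((Nat.le_add_left 1 k).trans (one_le_acceptedIndex (marks S) k))).symm⟩
  by_cases h1 : Skip (marks S) (m + 1)
  · have h2 : ¬ Switch (marks S) (m + 1) := h1.1
    simp [cycleLength, cycleArea, h1, h2, hm, headAge]
    ring
  · by_cases h2 : Switch (marks S) (m + 1)
    · simp [cycleLength, cycleArea, h1, h2, hm, headAge]
      ring
    · simp [cycleLength, cycleArea, h1, h2, hm, headAge]

namespace Regular

variable {S : Sensor → ℕ → ℝ} (hS : Regular S) {a₀ : ℝ}
include hS

theorem interArrival_eq (ha : 0 ≤ a₀) {δ : ℕ}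
    (hδ : ∀ (j : ℕ → Sensor) n, refreshIndex a₀ j (n + 1) = acceptedIndex j (n + δ)) (n : ℕ) :
    interArrival a₀ S (n + 2) = cycleLength (n + δ) S := by
  rw [hS.interArrival_succ ha, hδ, hδ, ← epoch_acceptedIndex_succ]
  congr 3
  ring

theorem area_eq (ha : 0 ≤ a₀) {δ : ℕ}
    (hδ : ∀ (j : ℕ → Sensor) n, refreshIndex a₀ j (n + 1) = acceptedIndex j (n + δ)) (n : ℕ) :
    area a₀ S (n + 2) = cycleArea (n + δ) S := by
  rw [hS.area_succ ha, hS.interArrival_eq ha hδ, hδ, headAge_mul_cycleLength]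

/-- The area is determined by the service time of the preceding successfully received update. -/
theorem exists_area_eq (ha : 0 ≤ a₀) {n : ℕ} (hn : 2 ≤ n) : ∃ i k, IsFresh a₀ S i k ∧
    delTime S i k = refreshTime a₀ S (n - 1) ∧
    area a₀ S n = S i k * interArrival a₀ S n + interArrival a₀ S n ^ 2 / 2 := by
  obtain ⟨n, rfl⟩ : ∃ m, n = m + 2 := ⟨n - 2, by omega⟩
  obtain ⟨i, k, h1, h2, h3⟩ := hS.exists_isFresh ha (accepted_refreshIndex_succ a₀ (marks S) n)
  refine ⟨i, k, h1, ?_, ?_⟩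
  · rw [h2, show n + 2 - 1 = n + 1 by omega, hS.refreshTime_eq ha]
  · rw [h3]; exact hS.area_succ ha (n + 1)

end Regular

section

variable {μ : Sensor → ℝ} (hμ : ∀ i, 0 < μ i)
include hμ

theorem memLp_epoch (n : ℕ) : MemLp (fun S => epoch (gaps S) n) 2 (mmLaw μ) :=
  memLp_finsetSum _ fun k _ => memLp_gaps hμ k

omit hμ in
theorem measurable_refreshIndex_one (a₀ : ℝ) : Measurable fun j => refreshIndex a₀ j 1 := by
  obtain ⟨δ, hδ⟩ := exists_refreshIndex_succ_eq a₀
  simp only [hδ _ 0]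
  exact measurable_acceptedIndex _

/-- The first reception is treated apart from the cycles: its index is determined by the marks and
is at most 3, so finitely many epochs are involved. -/
theorem integrable_interArrival_one {a₀ : ℝ} (ha : 0 ≤ a₀) :
    Integrable (fun S => interArrival a₀ S 1) (mmLaw μ) := by
  have hP := isProbabilityMeasure_mmLaw hμ
  have h := integrable_randomIndex hμ MeasurableSet.univ (measurable_refreshIndex_one a₀) (N := 4)
    (fun j => by have := refreshIndex_le a₀ j 1; omega) (φ := fun m e => epoch e m)
    (fun m => (memLp_epoch hμ m).integrable (by norm_num))
  refine h.congr ?_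
  filter_upwards [ae_regular hμ] with S hS
  rw [hS.interArrival_succ ha 0]
  simp [refreshIndex, epoch_zero]

theorem integrable_area_one {a₀ : ℝ} (ha : 0 ≤ a₀) :
    Integrable (fun S => area a₀ S 1) (mmLaw μ) := by
  have hP := isProbabilityMeasure_mmLaw hμ
  have h := integrable_randomIndex hμ MeasurableSet.univ (measurable_refreshIndex_one a₀) (N := 4)
    (fun j => by have := refreshIndex_le a₀ j 1; omega)
    (φ := fun m e => a₀ * epoch e m + epoch e m ^ 2 / 2)
    (fun m => (((memLp_epoch hμ m).integrable (by norm_num)).const_mul a₀).add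
      ((memLp_epoch hμ m).integrable_sq.div_const 2))
  refine h.congr ?_
  filter_upwards [ae_regular hμ] with S hS
  rw [hS.area_succ ha 0, hS.interArrival_succ ha 0]
  simp [refreshIndex, epoch_zero, headAge]

theorem cycleLength_integral (k : ℕ) : Integrable (cycleLength k) (mmLaw μ)
    ∧ ∫ S, cycleLength k S ∂(mmLaw μ)
      = (1 + (mmLaw μ).real {S | Skip (marks S) (acceptedIndex (marks S) k)})
        / (μ Sensor.A + μ Sensor.B) := by
  have hP := isProbabilityMeasure_mmLaw hμ
  have hf := measurable_acceptedIndex k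
  have hN : ∀ j : ℕ → Sensor, acceptedIndex j k < 2 * k + 2 := fun j => by
    have := acceptedIndex_le j k; omega
  have hD := measurableSet_randomIndex measurableSet_skip hf
  have i1 := integrable_randomIndex hμ MeasurableSet.univ hf hN (φ := fun m e => e m)
    (fun m => integrable_gaps hμ m)
  have v1 := integral_randomIndex hμ MeasurableSet.univ hf hN (φ := fun m e => e m)
    (fun m => measurable_pi_apply m) (fun m => integrable_gaps hμ m)
    (fun j _ => integral_gaps hμ _)
  have i2 := integrable_randomIndex hμ hD hf hN (φ := fun m e => e (m + 1))
    (fun m => integrable_gaps hμ (m + 1))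
  have v2 := integral_randomIndex hμ hD hf hN (φ := fun m e => e (m + 1))
    (fun m => measurable_pi_apply (m + 1)) (fun m => integrable_gaps hμ (m + 1))
    (fun j _ => integral_gaps hμ _)
  simp only [Set.preimage_univ, Set.indicator_univ, probReal_univ, mul_one] at i1 v1
  refine ⟨i1.add i2, ?_⟩
  have h := integral_add i1 i2
  rw [v1, v2] at h
  refine Eq.trans h ?_
  rw [add_div, one_div_mul_eq_div]
  rfl

theorem cycleArea_integral (k : ℕ) : Integrable (cycleArea k) (mmLaw μ)
    ∧ ∫ S, cycleArea k S ∂(mmLaw μ)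
      = (2 + 3 * (mmLaw μ).real {S | Skip (marks S) (acceptedIndex (marks S) k)}
          + (mmLaw μ).real {S | Switch (marks S) (acceptedIndex (marks S) k)})
        / (μ Sensor.A + μ Sensor.B) ^ 2 := by
  have hP := isProbabilityMeasure_mmLaw hμ
  have hs := add_pos (hμ Sensor.A) (hμ Sensor.B)
  have hf := measurable_acceptedIndex k
  have hN : ∀ j : ℕ → Sensor, acceptedIndex j k < 2 * k + 2 := fun j => by
    have := acceptedIndex_le j k; omega
  -- Positivity keeps `m - 1` and `m - 1 - 1` different from `m` under truncated subtraction, so the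
  -- products involve distinct, hence independent, gaps.
  have hpos : ∀ j : ℕ → Sensor, 1 ≤ acceptedIndex j k := fun j =>
    (Nat.le_add_left 1 k).trans (one_le_acceptedIndex j k)
  have hD := measurableSet_randomIndex measurableSet_skip hf
  have hE := measurableSet_randomIndex measurableSet_switch hf
  have hsq : ∀ m, Integrable (fun S => gaps S m ^ 2 / 2) (mmLaw μ) := fun m =>
    (integrable_gaps_pow hμ m 2).div_const 2
  -- Half squares have the same mean as products of distinct gaps, so the mean area just counts
  -- terms: two always, three more on a skip, one more on a switch.
  have hsqv : ∀ m, ∫ S, gaps S m ^ 2 / 2 ∂(mmLaw μ) = 1 / (μ Sensor.A + μ Sensor.B) ^ 2 := by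
    intro m
    rw [integral_div, integral_gaps_pow hμ]
    simp only [Nat.factorial]
    push_cast
    ring
  have n1 : ∀ m, Integrable (fun S => gaps S (m - 1) * gaps S m + gaps S m ^ 2 / 2) (mmLaw μ) :=
    fun m => (integrable_gaps_mul hμ _ _).add (hsq m)
  have c1 : ∀ m, 1 ≤ m → ∫ S, (gaps S (m - 1) * gaps S m + gaps S m ^ 2 / 2) ∂(mmLaw μ)
      = 2 / (μ Sensor.A + μ Sensor.B) ^ 2 := by
    intro m hm
    rw [integral_add (integrable_gaps_mul hμ _ _) (hsq m), hsqv, integral_gaps_mul hμ (by omega)]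
    ring
  have n2' : ∀ m, Integrable (fun S => gaps S (m - 1) * gaps S (m + 1)
      + gaps S m * gaps S (m + 1)) (mmLaw μ) := fun m =>
    (integrable_gaps_mul hμ _ _).add (integrable_gaps_mul hμ _ _)
  have n2 : ∀ m, Integrable (fun S => gaps S (m - 1) * gaps S (m + 1)
      + gaps S m * gaps S (m + 1) + gaps S (m + 1) ^ 2 / 2) (mmLaw μ) := fun m =>
    (n2' m).add (hsq (m + 1))
  have c2 : ∀ m, ∫ S, (gaps S (m - 1) * gaps S (m + 1) + gaps S m * gaps S (m + 1)
      + gaps S (m + 1) ^ 2 / 2) ∂(mmLaw μ) = 3 / (μ Sensor.A + μ Sensor.B) ^ 2 := by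
    intro m
    rw [integral_add (n2' m) (hsq (m + 1)), integral_add (integrable_gaps_mul hμ _ _)
      (integrable_gaps_mul hμ _ _), hsqv, integral_gaps_mul hμ (by omega),
      integral_gaps_mul hμ (by omega)]
    ring
  have i1 := integrable_randomIndex hμ MeasurableSet.univ hf hN
    (φ := fun m e => e (m - 1) * e m + e m ^ 2 / 2) n1
  have v1 := integral_randomIndex hμ MeasurableSet.univ hf hN
    (φ := fun m e => e (m - 1) * e m + e m ^ 2 / 2) (fun m => by fun_prop) n1
    (fun j _ => c1 _ (hpos j))
  have i2 := integrable_randomIndex hμ hD hf hN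
    (φ := fun m e => e (m - 1) * e (m + 1) + e m * e (m + 1) + e (m + 1) ^ 2 / 2) n2
  have v2 := integral_randomIndex hμ hD hf hN
    (φ := fun m e => e (m - 1) * e (m + 1) + e m * e (m + 1) + e (m + 1) ^ 2 / 2)
    (fun m => by fun_prop) n2 (fun j _ => c2 _)
  have i3 := integrable_randomIndex hμ hE hf hN (φ := fun m e => e (m - 1 - 1) * e m)
    (fun m => integrable_gaps_mul hμ _ _)
  have v3 := integral_randomIndex hμ hE hf hN (φ := fun m e => e (m - 1 - 1) * e m)
    (fun m => by fun_prop) (fun m => integrable_gaps_mul hμ _ _)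
    (fun j _ => integral_gaps_mul hμ (by have := hpos j; omega))
  simp only [Set.preimage_univ, Set.indicator_univ, probReal_univ, mul_one] at i1 v1
  refine ⟨(i1.add i2).add i3, ?_⟩
  have h := integral_add i1 i2
  have h' := integral_add (i1.add i2) i3
  simp only [Pi.add_apply] at h'
  rw [v1, v2] at h
  rw [h, v3] at h'
  refine Eq.trans h' ?_
  rw [add_div, add_div, mul_div_right_comm, one_div_mul_eq_div]
  rfl

theorem integrable_area {a₀ : ℝ} (ha : 0 ≤ a₀) {n : ℕ} (hn : 1 ≤ n) :
    Integrable (fun S => area a₀ S n) (mmLaw μ) := by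
  obtain ⟨δ, hδ⟩ := exists_refreshIndex_succ_eq a₀
  obtain rfl | ⟨m, rfl⟩ : n = 1 ∨ ∃ m, n = m + 2 := by
    rcases Nat.lt_or_ge 1 n with h | h
    · exact Or.inr ⟨n - 2, by omega⟩
    · exact Or.inl (by omega)
  · exact integrable_area_one hμ ha
  · refine (cycleArea_integral hμ (m + δ)).1.congr ?_
    filter_upwards [ae_regular hμ] with S hS
    exact (hS.area_eq ha hδ m).symm

theorem integrable_interArrival {a₀ : ℝ} (ha : 0 ≤ a₀) {n : ℕ} (hn : 1 ≤ n) :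
    Integrable (fun S => interArrival a₀ S n) (mmLaw μ) := by
  obtain ⟨δ, hδ⟩ := exists_refreshIndex_succ_eq a₀
  obtain rfl | ⟨m, rfl⟩ : n = 1 ∨ ∃ m, n = m + 2 := by
    rcases Nat.lt_or_ge 1 n with h | h
    · exact Or.inr ⟨n - 2, by omega⟩
    · exact Or.inl (by omega)
  · exact integrable_interArrival_one hμ ha
  · refine (cycleLength_integral hμ (m + δ)).1.congr ?_
    filter_upwards [ae_regular hμ] with S hS
    exact (hS.interArrival_eq ha hδ m).symm

theorem tendsto_integral_area {a₀ : ℝ} (ha : 0 ≤ a₀) :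
    Tendsto (fun n : ℕ => ∫ S, area a₀ S n ∂(mmLaw μ)) atTop
      (𝓝 ((2 + 4 * (markProb μ Sensor.A * markProb μ Sensor.B
        / (1 - markProb μ Sensor.A * markProb μ Sensor.B))) / (μ Sensor.A + μ Sensor.B) ^ 2)) := by
  obtain ⟨δ, hδ⟩ := exists_refreshIndex_succ_eq a₀
  rw [← tendsto_add_atTop_iff_nat 2]
  have h1 := (((tendsto_measure_skip hμ).const_mul 3).const_add 2).add (tendsto_measure_switch hμ)
  have h2 := (tendsto_add_atTop_iff_nat δ).2 (h1.div_const ((μ Sensor.A + μ Sensor.B) ^ 2))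
  have h3 : ∀ r : ℝ, 2 + 3 * r + r = 2 + 4 * r := fun r => by ring
  rw [h3] at h2
  refine h2.congr fun n => ?_
  rw [← (cycleArea_integral hμ (n + δ)).2]
  refine integral_congr_ae ?_
  filter_upwards [ae_regular hμ] with S hS
  exact (hS.area_eq ha hδ n).symm

theorem tendsto_integral_interArrival {a₀ : ℝ} (ha : 0 ≤ a₀) :
    Tendsto (fun n : ℕ => ∫ S, interArrival a₀ S n ∂(mmLaw μ)) atTop
      (𝓝 ((1 + markProb μ Sensor.A * markProb μ Sensor.B
        / (1 - markProb μ Sensor.A * markProb μ Sensor.B)) / (μ Sensor.A + μ Sensor.B))) := by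
  obtain ⟨δ, hδ⟩ := exists_refreshIndex_succ_eq a₀
  rw [← tendsto_add_atTop_iff_nat 2]
  have h1 := (tendsto_measure_skip hμ).const_add 1
  have h2 := (tendsto_add_atTop_iff_nat δ).2 (h1.div_const (μ Sensor.A + μ Sensor.B))
  refine h2.congr fun n => ?_
  rw [← (cycleLength_integral hμ (n + δ)).2]
  refine integral_congr_ae ?_
  filter_upwards [ae_regular hμ] with S hS
  exact (hS.interArrival_eq ha hδ n).symm

end

/-- The rates of the two sensors. -/
def rates (μA μB : ℝ) : Sensor → ℝ
  | Sensor.A => μA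
  | Sensor.B => μB

theorem IsMMSystem.hasLaw {Ω : Type*} [MeasurableSpace Ω] {P : Measure Ω} {μA μB : ℝ}
    {S : Sensor → ℕ → Ω → ℝ} (hS : IsMMSystem P μA μB S) :
    HasLaw (fun ω i k => S i k ω) (mmLaw (rates μA μB)) P := by
  refine hasLaw_serviceLaw (fun i k => ?_) hS.indep
  cases i
  · exact hS.law_A k
  · exact hS.law_B k

end DualQueue

/-! ### The theorem, by transfer from the canonical space -/

theorem proposition2 {Ω : Type*} [MeasurableSpace Ω] (P : Measure Ω) [IsProbabilityMeasure P]
    (μA μB : ℝ) (hA : 0 < μA) (hB : 0 < μB) (a₀ : ℝ) (ha₀ : 0 ≤ a₀)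
    (S : DualQueue.Sensor → ℕ → Ω → ℝ) (hS : DualQueue.IsMMSystem P μA μB S) :
    -- the long-run time average of the age of information
    (∀ᵐ ω ∂P, Tendsto (fun τ : ℝ => DualQueue.timeAvgAoI a₀ (fun i k => S i k ω) τ) atTop
      (𝓝 (2 * (μA ^ 2 + 3 * μA * μB + μB ^ 2) / (μA + μB) ^ 3))) ∧
    -- the same average through the areas of the successfully received updates
    (∀ᵐ ω ∂P, Tendsto (fun τ : ℝ => DualQueue.timeAvgArea a₀ (fun i k => S i k ω) τ) atTop
      (𝓝 (2 * (μA ^ 2 + 3 * μA * μB + μB ^ 2) / (μA + μB) ^ 3))) ∧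
    -- equal rates
    (∀ μ : ℝ, μA = μ → μB = μ → ∀ᵐ ω ∂P,
      Tendsto (fun τ : ℝ => DualQueue.timeAvgAoI a₀ (fun i k => S i k ω) τ) atTop
        (𝓝 (5 / (4 * μ)))) ∧
    -- the area is given by the service time of the previous successfully received update and
    -- the current inter-arrival time
    (∀ᵐ ω ∂P, ∀ n : ℕ, 2 ≤ n → ∃ (i : DualQueue.Sensor) (k : ℕ),
      DualQueue.IsFresh a₀ (fun i k => S i k ω) i k ∧
      DualQueue.delTime (fun i k => S i k ω) i k
        = DualQueue.refreshTime a₀ (fun i k => S i k ω) (n - 1) ∧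
      DualQueue.area a₀ (fun i k => S i k ω) n
        = S i k ω * DualQueue.interArrival a₀ (fun i k => S i k ω) n
          + DualQueue.interArrival a₀ (fun i k => S i k ω) n ^ 2 / 2) ∧
    -- the average is the ratio of the steady-state means of area and inter-arrival time
    (∀ n : ℕ, 1 ≤ n →
      Integrable (fun ω => DualQueue.area a₀ (fun i k => S i k ω) n) P ∧
      Integrable (fun ω => DualQueue.interArrival a₀ (fun i k => S i k ω) n) P) ∧
    (∃ EQ EY : ℝ, 0 < EY ∧
      Tendsto (fun n : ℕ => ∫ ω, DualQueue.area a₀ (fun i k => S i k ω) n ∂P) atTop (𝓝 EQ) ∧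
      Tendsto (fun n : ℕ => ∫ ω, DualQueue.interArrival a₀ (fun i k => S i k ω) n ∂P) atTop
        (𝓝 EY) ∧
      2 * (μA ^ 2 + 3 * μA * μB + μB ^ 2) / (μA + μB) ^ 3 = EQ / EY) := by
  have hμ : ∀ i, 0 < DualQueue.rates μA μB i := by
    intro i
    cases i
    · exact hA
    · exact hB
  have hlaw := hS.hasLaw
  -- Every claim concerns only the joint law of the service times, which is `mmLaw`; almost sure
  -- statements and integrals are pulled back along it.
  have hae : ∀ {p : (DualQueue.Sensor → ℕ → ℝ) → Prop},
      (∀ᵐ x ∂(DualQueue.mmLaw (DualQueue.rates μA μB)), p x) → ∀ᵐ ω ∂P, p fun i k => S i k ω := by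
    intro p hp
    rw [← hlaw.map_eq] at hp
    exact ae_of_ae_map hlaw.aemeasurable hp
  have hint : ∀ {F : (DualQueue.Sensor → ℕ → ℝ) → ℝ},
      Integrable F (DualQueue.mmLaw (DualQueue.rates μA μB)) →
      Integrable (fun ω => F fun i k => S i k ω) P ∧ ∫ ω, F (fun i k => S i k ω) ∂P
        = ∫ x, F x ∂(DualQueue.mmLaw (DualQueue.rates μA μB)) := by
    intro F hF
    rw [← hlaw.map_eq] at hF ⊢
    exact ⟨hF.comp_aemeasurable hlaw.aemeasurable,
      (integral_map hlaw.aemeasurable hF.aestronglyMeasurable).symm⟩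
  have hAoI := hae (DualQueue.ae_tendsto_timeAvgAoI hμ ha₀)
  have hp := DualQueue.one_sub_mul_pos (DualQueue.markProb_pos hμ) (DualQueue.markProb_sum hμ)
  have hpA := DualQueue.markProb_pos hμ DualQueue.Sensor.A
  have hpB := DualQueue.markProb_pos hμ DualQueue.Sensor.B
  refine ⟨hAoI, hae (DualQueue.ae_tendsto_timeAvgArea hμ ha₀), ?_, ?_, ?_, ?_⟩
  · rintro μ rfl rfl
    filter_upwards [hAoI] with ω hω
    convert hω using 2
    simp only [DualQueue.rates]
    field_simp
    ring
  · filter_upwards [hae (DualQueue.ae_regular hμ)] with ω hω n hn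
    exact hω.exists_area_eq ha₀ hn
  · intro n hn
    exact ⟨(hint (DualQueue.integrable_area hμ ha₀ hn)).1,
      (hint (DualQueue.integrable_interArrival hμ ha₀ hn)).1⟩
  · refine ⟨_, _, ?_, (DualQueue.tendsto_integral_area hμ ha₀).congr' ?_,
      (DualQueue.tendsto_integral_interArrival hμ ha₀).congr' ?_, ?_⟩
    · have := div_pos (mul_pos hpA hpB) hp
      exact div_pos (by linarith) (add_pos hA hB)
    · filter_upwards [eventually_ge_atTop 1] with n hn
      exact (hint (DualQueue.integrable_area hμ ha₀ hn)).2.symm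
    · filter_upwards [eventually_ge_atTop 1] with n hn
      exact (hint (DualQueue.integrable_interArrival hμ ha₀ hn)).2.symm
    -- Rewriting `1 - p * q` as a quotient of positive polynomials lets the remaining identity of
    -- rational functions be cleared of denominators.
    · have h1 : (1 - DualQueue.markProb (DualQueue.rates μA μB) DualQueue.Sensor.A
          * DualQueue.markProb (DualQueue.rates μA μB) DualQueue.Sensor.B)
          = (μA ^ 2 + μA * μB + μB ^ 2) / (μA + μB) ^ 2 := by
        simp only [DualQueue.markProb, DualQueue.rates]
        field_simp
        ring
      rw [h1]
      simp only [DualQueue.markProb, DualQueue.rates]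
      field_simp
      ring
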